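/- **Conventions.** Let $G$ be a group generated by a finite family $X$, and let $\Gamma_X(G)$ be its Cayley graph. $G$ is *hyperbolic* if for some finite generating set $X$ there is $\delta\ge 0$ such that in $\Gamma_X(G)$ every side of every geodesic triangle is contained in the closed $\delta$-neighbourhood of the union of the other two sides. A *finite Dehn presentation* of $G$ is a finite presentation $\langle X\mid R\rangle$ of $G$ with cyclically reduced relators for which Dehn's algorithm decides whether a reduced word is equal to $1$ in $G$; the algorithm is: as long as a cyclic shift of the current word has the form $ut$, where $uv$ is a cyclic shift of some $r^{\pm1}$, $r\in R$, and $|u|>|v|$, replace $ut$ by the reduced form of $v^{-1}t$; when this is no longer possible, the input is declared equal to $1$ in $G$ exactly if the word obtained is empty. The *Dehn function* of $\langle X\mid R\rangle$ assigns to $k$ the largest area of a word of length at most $k$ that is equal to $1$ in $G$, the area of $w$ being the least number of factors in an expression of $w$, in the free group on $X$, as a product of conjugates of elements of $R^{\pm1}$. A path of length $l$ in $\Gamma_X(G)$ is a *bump* if $l$ is at least three times the distance between its end points. **Theorem.** Let $G$ be a group. 1. If $G$ is hyperbolic, then $G$ is finitely presented, $G$ has a finite Dehn presentation, and the Dehn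 function of every finite presentation of $G$ is at most linear: it is bounded by $Kk$ for some constant $K$ depending on the presentation. 2. $G$ is hyperbolic if and only if $G$ has a finite Dehn presentation. 3. If $G$ is hyperbolic, then for every finite generating family $X$ of $G$ there is a constant $C$ such that every closed edge path of positive length in $\Gamma_X(G)$ has a subpath of positive length at most $C$ that is a bump, and the set $R$ of all cyclically reduced words over $X$ of length at most $2C$ that are equal to $1$ in $G$ gives a finite Dehn presentation $\langle X\mid R\rangle$ of $G$. -/

import Mathlib

/-- A graph is `δ`-hyperbolic in the sense of Rips: for all vertices `a b c` and all geodesic paths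
`p`, `q`, `r` joining them (a geodesic triangle), every vertex of the side `p` is at distance at
most `δ` from a vertex of one of the other two sides. As all triangles are considered, this is the
condition for each of the three sides. -/
def SimpleGraph.IsRipsHyperbolic {V : Type*} (Γ : SimpleGraph V) (δ : ℝ) : Prop :=
  ∀ (a b c : V) (p : Γ.Walk a b) (q : Γ.Walk b c) (r : Γ.Walk c a),
    p.length = Γ.dist a b → q.length = Γ.dist b c → r.length = Γ.dist c a →
    ∀ v ∈ p.support, ∃ w, (w ∈ q.support ∨ w ∈ r.support) ∧ (Γ.dist v w : ℝ) ≤ δ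

/-- A group is (word) hyperbolic if it has a finite generating set whose Cayley graph is
`δ`-hyperbolic for some `δ ≥ 0`. -/
def IsHyperbolicGroup (G : Type*) [Group G] : Prop :=
  ∃ S : Set G, S.Finite ∧ Subgroup.closure S = ⊤ ∧
    ∃ δ : ℝ, 0 ≤ δ ∧ (SimpleGraph.mulCayley S).IsRipsHyperbolic δ

section Presentations

variable {G : Type*} [Group G] {n : ℕ}

/-- `⟨X | R⟩`, where `X` is the family of the images under `φ` of the `n` free generators,
is a finite presentation of `G`. -/
structure IsFinitePresentation (φ : FreeGroup (Fin n) →* G) (R : Set (FreeGroup (Fin n))) :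
    Prop where
  surjective : Function.Surjective φ
  finite : R.Finite
  normalClosure_eq : Subgroup.normalClosure R = φ.ker

/-- One step of the Dehn algorithm from the group word `w` to the reduced group word `w₁`:
a cyclic shift `u ++ t` of `w` starts with more than a half `u` of a cyclic shift `u ++ v` of a
relator or of the inverse of a relator; `u ++ t` is replaced by `v⁻¹ ++ t`, and the result is
reduced. -/
def DehnStep (R : Set (FreeGroup (Fin n))) (w w₁ : List (Fin n × Bool)) : Prop :=
  ∃ r ∈ R, ∃ u v t : List (Fin n × Bool),
    ((u ++ v) ~r r.toWord ∨ (u ++ v) ~r r⁻¹.toWord) ∧ v.length < u.length ∧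
    (u ++ t) ~r w ∧ w₁ = FreeGroup.reduce (FreeGroup.invRev v ++ t)

/-- A finite presentation with cyclically reduced relators is a Dehn presentation if the
Dehn algorithm works for it: whenever the algorithm, started at a reduced word `w`, has arrived at a
word `w₁` at which no further step is possible, `w₁` is empty if and only if `w = 1` in `G`.
(Steps shorten words, so every run of the algorithm stops.) -/
structure IsDehnPresentation (φ : FreeGroup (Fin n) →* G) (R : Set (FreeGroup (Fin n))) : Prop
    extends IsFinitePresentation φ R where
  cyclicallyReduced : ∀ r ∈ R, FreeGroup.IsCyclicallyReduced r.toWord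
  algorithm_works : ∀ w w₁ : List (Fin n × Bool), FreeGroup.IsReduced w →
    Relation.ReflTransGen (DehnStep R) w w₁ → (∀ w₂, ¬ DehnStep R w₁ w₂) →
    (w₁ = [] ↔ φ (FreeGroup.mk w) = 1)

/-- The area of `w` over `R`: the least number of factors in a representation of `w` in the free
group as a product of conjugates of elements of `R` and of their inverses
(`⊤` if there is no such representation). -/
noncomputable def relatorArea (R : Set (FreeGroup (Fin n))) (w : FreeGroup (Fin n)) : ℕ∞ :=
  ⨅ l ∈ {l : List (FreeGroup (Fin n)) |
      (∀ y ∈ l, ∃ s, ∃ r ∈ R, y = s * r * s⁻¹ ∨ y = s * r⁻¹ * s⁻¹) ∧ l.prod = w},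
    (l.length : ℕ∞)

/-- The Dehn function of the presentation `(φ, R)`: the largest area of a word of
length at most `k` that is equal to `1` in `G`. -/
noncomputable def dehnFunction (φ : FreeGroup (Fin n) →* G) (R : Set (FreeGroup (Fin n)))
    (k : ℕ) : ℕ∞ :=
  ⨆ w ∈ {w : FreeGroup (Fin n) | w.norm ≤ k ∧ φ w = 1}, relatorArea R w

/-- The group word `u` over the generators `x` labels bumps in the Cayley graph: its length is at
least three times the distance between the end points of a path labeled by `u`. -/
def IsBump (x : Fin n → G) (u : List (Fin n × Bool)) : Prop :=
  3 * (SimpleGraph.mulCayley (Set.range x)).dist 1 (FreeGroup.lift x (FreeGroup.mk u)) ≤ u.length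

/-- All cyclically reduced words of length at most `k` that are equal to `1` in `G`. -/
def shortRelators (x : Fin n → G) (k : ℕ) : Set (FreeGroup (Fin n)) :=
  {r | FreeGroup.IsCyclicallyReduced r.toWord ∧ r.norm ≤ k ∧ FreeGroup.lift x r = 1}

end Presentations

/-- `G` has a finite Dehn presentation. -/
def HasFiniteDehnPresentation (G : Type*) [Group G] : Prop :=
  ∃ (n : ℕ) (φ : FreeGroup (Fin n) →* G) (R : Set (FreeGroup (Fin n))), IsDehnPresentation φ R

/-- The Dehn function of every finite presentation of `G` is bounded by a linear function. -/
def HasLinearDehnFunction (G : Type*) [Group G] : Prop :=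
  ∀ (n : ℕ) (φ : FreeGroup (Fin n) →* G) (R : Set (FreeGroup (Fin n))),
    IsFinitePresentation φ R → ∃ K : ℕ, ∀ k : ℕ, dehnFunction φ R k ≤ ((K * k : ℕ) : ℕ∞)

/-! Hyperbolicity yields short bumps (`exists_bump`). If a closed path has none, take a shortest
subpath of positive length that is at least 30 times as long as the distance of its ends. It is
long, and without its last edge it is a quasi-geodesic, so every point of a geodesic between its
ends is near it. Advancing along that geodesic in bounded steps, the nearby points of the path stay
so close to each other that the absence of short bumps applies. This bounds the length by about 9
times the distance of the ends, against the factor 30. A bump `u` in a relation has the same value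
as a much shorter word `v`. After cancellation, `u v⁻¹` becomes a short cyclically reduced relator,
more than half of which occurs in the relation, so Dehn's algorithm can proceed
(`hasDehnSteps_shortRelators`). Each step shortens the word and costs one relator, whence area is at
most length.

For the converse, integrate `f dg` along paths, where `f` and `g` are Lipschitz. Integrals around
relators are bounded and add up over a filling, so linear area makes integrals along closed paths
linear in their length (`exists_hasLinearIntegrals`). In a fat geodesic triangle some point `x` of a
side is at distance `E` from the other sides, and a detour of length `O(E)` avoids the ball of
radius `E` about `x`. With `f` a distance function and `g` a cone supported in that ball, the
integral along the side and the detour has order `E²`; hence `E` is bounded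
(`HasLinearIntegrals.isRipsHyperbolic`).

The integral bound is easily carried over to any finite generating set. So hyperbolicity for one
generating set passes through the Dehn presentation to all of them, which gives the statements on
arbitrary presentations and generating families. -/

/-! ### Thin triangles, quasi-geodesics and bumps. -/

namespace SimpleGraph

variable {V : Type*} {Γ : SimpleGraph V} {a b c u v w x : V}

/-- The vertex `v` lies on a geodesic from `a` to `b`. -/
def IsBetween (Γ : SimpleGraph V) (a v b : V) : Prop := Γ.dist a v + Γ.dist v b = Γ.dist a b

lemma IsBetween.symm (h : Γ.IsBetween a v b) : Γ.IsBetween b v a := by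
  have := h
  unfold IsBetween at *
  rw [Γ.dist_comm (u := b), Γ.dist_comm (u := b), Γ.dist_comm (u := v) (v := a)]
  omega

lemma isBetween_right (a b : V) : Γ.IsBetween a b b := by simp [IsBetween]

lemma IsBetween.trans_left (hΓ : Γ.Connected) (h : Γ.IsBetween a v b) (h' : Γ.IsBetween a u v) :
    Γ.IsBetween a u b := by
  have h1 := hΓ.dist_triangle (u := a) (v := u) (w := b)
  have h2 := hΓ.dist_triangle (u := u) (v := v) (w := b)
  unfold IsBetween at *
  omega

lemma IsBetween.trans_right (hΓ : Γ.Connected) (h : Γ.IsBetween a v b) (h' : Γ.IsBetween v u b) :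
    Γ.IsBetween a u b :=
  (h.symm.trans_left hΓ h'.symm).symm

lemma IsBetween.middle_left (hΓ : Γ.Connected) (h : Γ.IsBetween a v b) (h' : Γ.IsBetween a u v) :
    Γ.IsBetween u v b := by
  have h1 := hΓ.dist_triangle (u := a) (v := u) (w := b)
  have h2 := hΓ.dist_triangle (u := u) (v := v) (w := b)
  unfold IsBetween at *
  omega

lemma IsBetween.middle_right (hΓ : Γ.Connected) (h : Γ.IsBetween a v b)
    (h' : Γ.IsBetween v u b) : Γ.IsBetween a v u :=
  (h.symm.middle_left hΓ h'.symm).symm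

lemma isBetween_getVert (hΓ : Γ.Connected) (p : Γ.Walk a b) (hp : p.length = Γ.dist a b) {k : ℕ}
    (hk : k ≤ p.length) : Γ.IsBetween a (p.getVert k) b ∧ Γ.dist a (p.getVert k) = k := by
  have h1 := Γ.dist_le (p.take k)
  have h2 := Γ.dist_le (p.drop k)
  have h3 := hΓ.dist_triangle (u := a) (v := p.getVert k) (w := b)
  rw [Walk.take_length] at h1
  rw [Walk.drop_length] at h2
  rw [min_eq_left hk] at h1
  unfold IsBetween
  omega

lemma exists_isBetween_dist_eq (hΓ : Γ.Connected) (a b : V) {k : ℕ} (hk : k ≤ Γ.dist a b) :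
    ∃ v, Γ.IsBetween a v b ∧ Γ.dist a v = k := by
  obtain ⟨p, hp⟩ := hΓ.exists_walk_length_eq_dist a b
  exact ⟨p.getVert k, isBetween_getVert hΓ p hp (hp ▸ hk)⟩

lemma isBetween_of_mem_support (hΓ : Γ.Connected) (p : Γ.Walk a b) (hp : p.length = Γ.dist a b)
    (hv : v ∈ p.support) : Γ.IsBetween a v b := by
  obtain ⟨k, rfl, hk⟩ := Walk.mem_support_iff_exists_getVert.1 hv
  exact (isBetween_getVert hΓ p hp hk).1

/-- Among the points of an interval there is one at the largest distance from a given set. -/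
lemma exists_farthest (a b : V) {A : Set V} (hA : A.Nonempty) (hΓ : Γ.Connected) :
    ∃ E x, Γ.IsBetween a x b ∧ (∀ w ∈ A, E ≤ Γ.dist x w) ∧
      ∀ y, Γ.IsBetween a y b → ∃ w ∈ A, Γ.dist y w ≤ E := by
  classical
  obtain ⟨w₀, hw₀⟩ := hA
  let P : ℕ → Prop := fun E ↦ ∃ x, Γ.IsBetween a x b ∧ ∀ w ∈ A, E ≤ Γ.dist x w
  have hP0 : P 0 := ⟨b, isBetween_right a b, fun _ _ ↦ Nat.zero_le _⟩
  have hb : ∀ E, P E → E ≤ Γ.dist a b + Γ.dist b w₀ := by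
    rintro E ⟨x, hx, h⟩
    have := h w₀ hw₀
    have := hΓ.dist_triangle (u := x) (v := b) (w := w₀)
    unfold IsBetween at hx
    omega
  have hmax := Nat.findGreatest_spec (P := P) (Nat.zero_le (Γ.dist a b + Γ.dist b w₀)) hP0
  obtain ⟨x, hx, h⟩ := hmax
  refine ⟨_, x, hx, h, fun y hy ↦ ?_⟩
  by_contra! hcon
  have hP : P (Nat.findGreatest P (Γ.dist a b + Γ.dist b w₀) + 1) :=
    ⟨y, hy, fun w hw ↦ hcon w hw⟩
  have := Nat.le_findGreatest (hb _ hP) hP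
  omega

/-- From a point `x` of an interval that is farthest from `A`, one can move along the interval and
then to `A` at bounded cost and without coming close to `x` again. -/
lemma exists_escape (hΓ : Γ.Connected) {A : Set V} {E B : ℕ} (hx : Γ.IsBetween a x b)
    (hxE : ∀ w ∈ A, E ≤ Γ.dist x w) (hE : ∀ y, Γ.IsBetween a y b → ∃ w ∈ A, Γ.dist y w ≤ E)
    (hb : ∃ w ∈ A, Γ.dist b w ≤ B) (hB : B ≤ E) :
    ∃ z, ∃ w ∈ A, Γ.IsBetween x z b ∧ Γ.dist x z ≤ 2 * E ∧ Γ.dist z w ≤ E ∧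
      ∀ v, Γ.IsBetween z v w → E ≤ Γ.dist x v + B := by
  by_cases hxb : Γ.dist x b ≤ 2 * E
  · obtain ⟨w, hw, hbw⟩ := hb
    refine ⟨b, w, hw, isBetween_right _ _, hxb, hbw.trans hB, fun v hv ↦ ?_⟩
    have := hxE w hw
    have := hΓ.dist_triangle (u := x) (v := v) (w := w)
    unfold IsBetween at hv
    omega
  -- A geodesic of length at most `E` that starts at distance `2 * E` from `x` stays at distance at
  -- least `E` from `x`.
  · obtain ⟨z, hz, hxz⟩ := exists_isBetween_dist_eq hΓ x b (k := 2 * E) (by omega)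
    obtain ⟨w, hw, hzw⟩ := hE z (hx.trans_right hΓ hz)
    refine ⟨z, w, hw, hz, hxz.le, hzw, fun v hv ↦ ?_⟩
    have := hΓ.dist_triangle (u := x) (v := v) (w := z)
    rw [Γ.dist_comm (u := v) (v := z)] at this
    unfold IsBetween at hv
    omega

/-- Thinness of triangles, stated for all points of their intervals. -/
def HasThinIntervals (Γ : SimpleGraph V) (δ : ℕ) : Prop :=
  ∀ a b c v, Γ.IsBetween a v b →
    ∃ w, Γ.dist v w ≤ δ ∧ (Γ.IsBetween a w c ∨ Γ.IsBetween c w b)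

/-- A point of an interval lies on a geodesic obtained by joining two geodesics at it. Distances are
integers, so `δ` may be rounded down. -/
lemma IsRipsHyperbolic.hasThinIntervals (hΓ : Γ.Connected) {δ : ℝ} (h : Γ.IsRipsHyperbolic δ) :
    Γ.HasThinIntervals ⌊δ⌋₊ := by
  intro a b c v hv
  obtain ⟨p₁, hp₁⟩ := hΓ.exists_walk_length_eq_dist a v
  obtain ⟨p₂, hp₂⟩ := hΓ.exists_walk_length_eq_dist v b
  obtain ⟨q, hq⟩ := hΓ.exists_walk_length_eq_dist b c
  obtain ⟨r, hr⟩ := hΓ.exists_walk_length_eq_dist c a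
  obtain ⟨w, hw, hvw⟩ := h a b c (p₁.append p₂) q r
    (by rw [Walk.length_append, hp₁, hp₂]; exact hv) hq hr v
    (by simp [Walk.mem_support_append_iff])
  refine ⟨w, Nat.le_floor hvw, ?_⟩
  rcases hw with hw | hw
  · exact Or.inr (isBetween_of_mem_support hΓ q hq hw).symm
  · exact Or.inl (isBetween_of_mem_support hΓ r hr hw).symm

/-- A geodesic is at logarithmic distance from every path between its end points. -/
lemma HasThinIntervals.exists_dist_path_le (hΓ : Γ.Connected) {δ : ℕ} (hδ : Γ.HasThinIntervals δ)
    (N : ℕ) {p : ℕ → V} {l i j : ℕ} (hp : ∀ k < l, Γ.dist (p k) (p (k + 1)) ≤ 1) (hij : i ≤ j)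
    (hjl : j ≤ l) (hN : j - i ≤ 2 ^ N) (hv : Γ.IsBetween (p i) v (p j)) :
    ∃ k, i ≤ k ∧ k ≤ j ∧ Γ.dist v (p k) ≤ δ * N + 1 := by
  induction N generalizing i j v with
  | zero =>
    refine ⟨i, le_rfl, hij, ?_⟩
    rw [Γ.dist_comm]
    unfold IsBetween at hv
    obtain rfl | rfl : j = i ∨ j = i + 1 := by simp at hN; omega
    · rw [dist_self] at hv; omega
    · have := hp i (by omega); omega
  | succ N ih =>
    have h2 : 2 ^ (N + 1) = 2 * 2 ^ N := by ring
    obtain ⟨w, hvw, hw | hw⟩ := hδ _ _ (p (i + (j - i) / 2)) v hv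
    · obtain ⟨k, h1, h3, h4⟩ := ih (by omega) (by omega) (by omega) hw
      have := hΓ.dist_triangle (u := v) (v := w) (w := p k)
      exact ⟨k, h1, by omega, by rw [mul_add]; omega⟩
    · obtain ⟨k, h1, h3, h4⟩ := ih (by omega) (by omega) (by omega) hw
      have := hΓ.dist_triangle (u := v) (v := w) (w := p k)
      exact ⟨k, by omega, by omega, by rw [mul_add]; omega⟩

/-- A number bounded by a linear function of its own logarithm is bounded. For large `D` choose `N`
proportional to `D`; then `2 ^ N` exceeds `l * D`, while the coefficient `a` is too large for the
resulting linear bound. -/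
lemma exists_forall_log_bound (δ l : ℕ) :
    ∃ H : ℕ, ∀ D, (∀ N, l * D ≤ 2 ^ N → D ≤ δ * N + (2 * δ + 1)) → D ≤ H := by
  have h1 : ∀ N : ℕ, N * N ≤ 2 * 2 ^ N := by
    intro N
    induction N with
    | zero => simp
    | succ N ih =>
      have := Nat.lt_two_pow_self (n := N)
      have h2 : 2 ^ (N + 1) = 2 * 2 ^ N := by ring
      rcases Nat.lt_or_ge N 3 with h | h
      · interval_cases N <;> norm_num
      · nlinarith
  let a := δ + (2 * δ + 1) + 1
  refine ⟨a * (4 * l * a + 1), fun D hD ↦ ?_⟩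
  by_contra! hlt
  obtain ⟨N, hN, hN'⟩ : ∃ N, a * N < D ∧ D ≤ a * (N + 1) := by
    refine ⟨(D - 1) / a, ?_, ?_⟩
    · have := Nat.mul_div_le (D - 1) a
      omega
    · have := Nat.lt_mul_div_succ (D - 1) (show 0 < a by simp [a])
      omega
  have hN2 : 4 * l * a + 1 ≤ N := by
    by_contra! h
    have : a * (N + 1) ≤ a * (4 * l * a + 1) := Nat.mul_le_mul_left _ (by omega)
    omega
  have h3 : l * D ≤ 2 ^ N := by
    have h4 : l * D ≤ l * (a * (N + 1)) := Nat.mul_le_mul_left _ hN'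
    have h5 : l * a * (N + 1) ≤ l * a * (2 * N) := Nat.mul_le_mul_left _ (by omega)
    have h6 : (4 * l * a) * N ≤ N * N := Nat.mul_le_mul_right _ (by omega)
    have := h1 N
    nlinarith
  have h7 := hD N h3
  have h8 : (2 * δ + 1) * 1 ≤ (2 * δ + 1) * N := Nat.mul_le_mul_left _ (by omega)
  simp only [a] at hN
  nlinarith

/-- A geodesic stays close to every quasi-geodesic with the same end points. -/
lemma HasThinIntervals.exists_dist_quasigeodesic_le (hΓ : Γ.Connected) {δ : ℕ}
    (hδ : Γ.HasThinIntervals δ) (l₀ : ℕ) :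
    ∃ H : ℕ, ∀ (p : ℕ → V) (l : ℕ), (∀ k < l, Γ.dist (p k) (p (k + 1)) ≤ 1) →
      (∀ i j, i ≤ j → j ≤ l → j - i ≤ l₀ * Γ.dist (p i) (p j)) →
      ∀ v, Γ.IsBetween (p 0) v (p l) → ∃ k ≤ l, Γ.dist v (p k) ≤ H := by
  obtain ⟨H, hH⟩ := exists_forall_log_bound δ (l₀ * 6)
  refine ⟨H, fun p l hp hq v hv ↦ ?_⟩
  let A : Set V := {w | ∃ k ≤ l, w = p k}
  obtain ⟨E, x, hx, hxE, hE⟩ := exists_farthest (p 0) (p l) (A := A) ⟨p 0, 0, by omega, rfl⟩ hΓ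
  obtain ⟨z, _, ⟨i, hi, rfl⟩, hz, hxz, hzi, hz'⟩ := exists_escape hΓ (B := 0) hx hxE hE
    ⟨p l, ⟨l, le_rfl, rfl⟩, by simp⟩ (by omega)
  obtain ⟨y, _, ⟨j, hj, rfl⟩, hy, hxy, hyj, hy'⟩ := exists_escape hΓ (B := 0) hx.symm hxE
    (fun y hy ↦ hE y hy.symm) ⟨p 0, ⟨0, by omega, rfl⟩, by simp⟩ (by omega)
  suffices hEH : E ≤ H by
    obtain ⟨_, ⟨k, hk, rfl⟩, hvk⟩ := hE v hv
    exact ⟨k, hk, hvk.trans hEH⟩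
  apply hH
  intro N hN
  -- The route through `z`, `x` and `y` has length at most `E + 2E + 2E + E`.
  have hij : Γ.dist (p i) (p j) ≤ 6 * E := by
    have h1 := hΓ.dist_triangle (u := p i) (v := z) (w := p j)
    have h2 := hΓ.dist_triangle (u := z) (v := x) (w := p j)
    have h3 := hΓ.dist_triangle (u := x) (v := y) (w := p j)
    rw [Γ.dist_comm (u := p i) (v := z)] at h1
    rw [Γ.dist_comm (u := z) (v := x)] at h2
    omega
  have hlog : ∀ w, Γ.IsBetween (p i) w (p j) → ∃ k ≤ l, Γ.dist w (p k) ≤ δ * N + 1 := by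
    intro w hw
    have h6 : l₀ * Γ.dist (p i) (p j) ≤ 2 ^ N :=
      (Nat.mul_le_mul_left _ hij).trans (by rwa [← mul_assoc])
    rcases le_total i j with h | h
    · obtain ⟨k, h1, h2, h3⟩ := hδ.exists_dist_path_le hΓ N hp h hj
        ((hq i j h hj).trans h6) hw
      exact ⟨k, by omega, h3⟩
    · obtain ⟨k, h1, h2, h3⟩ := hδ.exists_dist_path_le hΓ N hp h hi
        ((hq j i h hi).trans (by rwa [Γ.dist_comm])) hw.symm
      exact ⟨k, by omega, h3⟩
  -- Two thin triangles make the quadrilateral `z`, `p i`, `p j`, `y` thin with constant `2 * δ`.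
  -- Either `x` is near an escape geodesic, which keeps away from `x`, or it is near the geodesic
  -- from `p i` to `p j`, which is logarithmically near the path.
  have hyz : Γ.IsBetween z x y :=
    ((hx.middle_right hΓ hz).middle_left hΓ hy.symm).symm
  obtain ⟨w, hxw, hw | hw⟩ := hδ z y (p i) x hyz
  · have := hz' w hw
    have := hxE
    omega
  obtain ⟨u, hwu, hu | hu⟩ := hδ (p i) y (p j) w hw
  · obtain ⟨k, hk, huk⟩ := hlog u hu
    have h1 := hxE (p k) ⟨k, hk, rfl⟩
    have h2 := hΓ.dist_triangle (u := x) (v := w) (w := p k)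
    have h3 := hΓ.dist_triangle (u := w) (v := u) (w := p k)
    omega
  · have := hy' u hu.symm
    have h2 := hΓ.dist_triangle (u := x) (v := w) (w := u)
    omega

/-- In a hyperbolic graph a closed path of positive length has a short subpath that is at least
three times as long as the distance between its end points. -/
theorem HasThinIntervals.exists_bump (hΓ : Γ.Connected) {δ : ℕ} (hδ : Γ.HasThinIntervals δ) :
    ∃ C : ℕ, ∀ (p : ℕ → V) (l : ℕ), 0 < l → (∀ k < l, Γ.dist (p k) (p (k + 1)) ≤ 1) →
      p 0 = p l → ∃ i j, i < j ∧ j ≤ l ∧ j - i ≤ C ∧ 3 * Γ.dist (p i) (p j) ≤ j - i := by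
  obtain ⟨H₀, hH₀⟩ := hδ.exists_dist_quasigeodesic_le hΓ 30
  obtain ⟨H, hH, hH1⟩ : ∃ H, H₀ ≤ H ∧ 1 ≤ H := ⟨H₀ + 1, by omega, by omega⟩
  refine ⟨90 * H + 100, fun p l hl hp hcl ↦ ?_⟩
  by_contra! hno
  classical
  -- By minimality of `m`, every shorter subpath satisfies the reverse inequality. Dropping one edge
  -- therefore leaves a quasi-geodesic with constant 30.
  have hex : ∃ m, 0 < m ∧ ∃ i, i + m ≤ l ∧ 30 * Γ.dist (p i) (p (i + m)) ≤ m :=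
    ⟨l, hl, 0, by omega, by simp [hcl]⟩
  obtain ⟨hm0, i, him, hm⟩ := Nat.find_spec hex
  have hmin : ∀ m' < Nat.find hex, 0 < m' → ∀ j, j + m' ≤ l →
      m' < 30 * Γ.dist (p j) (p (j + m')) := by
    intro m' hm' h0 j hj
    have := Nat.find_min hex hm'
    push Not at this
    exact this h0 j hj
  generalize Nat.find hex = m at *
  have hmC : 90 * H + 100 < m := by
    by_contra! h
    have := hno i (i + m) (by omega) him (by omega)
    omega
  obtain ⟨m, rfl⟩ : ∃ m', m = m' + 1 := ⟨m - 1, by omega⟩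
  have hpath : ∀ k < m, Γ.dist (p (i + k)) (p (i + (k + 1))) ≤ 1 := fun k hk ↦ hp _ (by omega)
  have hquasi : ∀ s t, s ≤ t → t ≤ m → t - s ≤ 30 * Γ.dist (p (i + s)) (p (i + t)) := by
    intro s t hst ht
    rcases hst.eq_or_lt with rfl | hst
    · simp
    · have := hmin (t - s) (by omega) (by omega) (i + s) (by omega)
      rw [show i + s + (t - s) = i + t by omega] at this
      omega
  have hnear := hH₀ (fun k ↦ p (i + k)) m hpath hquasi
  -- The quasi-geodesic bound makes the subpath at most `90 * H` long, hence short enough for the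
  -- absence of bumps to improve the factor 30 to 3.
  have hshort : ∀ s t, s ≤ t → t ≤ m → Γ.dist (p (i + s)) (p (i + t)) ≤ 3 * H →
      t - s ≤ 9 * H := by
    intro s t hst ht hd
    have h1 := hquasi s t hst ht
    rcases hst.eq_or_lt with rfl | hst
    · simp
    have := hno (i + s) (i + t) (by omega) (by omega) (by omega)
    omega
  -- Advance along the geodesic by steps of length `H`. Path points within `H` of consecutive
  -- geodesic points are at most `3 * H` apart, so each step uses up at most `9 * H` of the path.
  have hwalk : ∀ d v, Γ.IsBetween (p (i + 0)) v (p (i + m)) → Γ.dist v (p (i + m)) = d →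
      ∀ k ≤ m, Γ.dist v (p (i + k)) ≤ H → m - k ≤ 9 * (d + H) := by
    intro d
    induction d using Nat.strong_induction_on with
    | _ d ih =>
    intro v hv hd k hk hvk
    have h1 : ∀ w, Γ.dist (p (i + k)) w ≤ Γ.dist v (p (i + k)) + Γ.dist v w := fun w ↦ by
      rw [Γ.dist_comm (u := v) (v := p (i + k))]
      exact hΓ.dist_triangle
    by_cases hdH : d ≤ H
    · have := hshort k m hk le_rfl (by have := h1 (p (i + m)); omega)
      omega
    · obtain ⟨v', hv', hvv'⟩ := exists_isBetween_dist_eq hΓ v (p (i + m)) (k := H) (by omega)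
      have hv'' := hv.trans_right hΓ hv'
      obtain ⟨k', hk', hk'H⟩ := hnear v' hv''
      have hd' : Γ.dist v' (p (i + m)) + H = d := by
        unfold IsBetween at hv'
        omega
      have h2 := ih (d - H) (by omega) v' hv'' (by omega) k' hk' (hk'H.trans hH)
      rcases le_total k' k with h | h
      · omega
      · have h3 := hΓ.dist_triangle (u := v) (v := v') (w := p (i + k'))
        have := hshort k k' h hk' (by have := h1 (p (i + k')); omega)
        omega
  have h1 := hwalk _ (p (i + 0)) (isBetween_right _ _).symm rfl 0 (by omega) (by simp)
  have h2 := hΓ.dist_triangle (u := p (i + 0)) (v := p (i + (m + 1))) (w := p (i + m))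
  have h3 := hp (i + m) (by omega)
  rw [Γ.dist_comm, add_assoc] at h3
  simp only [Nat.add_zero] at *
  omega

end SimpleGraph

/-! ### Integrals of `f dg` along walks, and thin triangles. -/

namespace SimpleGraph

variable {V : Type*} {Γ : SimpleGraph V} {a b c u v w x y z : V}

/-- The integral, up to the factor `2`, of the form `f dg` along an edge from `u` to `v`. -/
def edgeIntegral (f g : V → ℤ) (u v : V) : ℤ := (f u + f v) * (g v - g u)

/-- The integral, up to the factor `2`, of the form `f dg` along a walk. -/
def Walk.integral (f g : V → ℤ) : {u v : V} → Γ.Walk u v → ℤ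
  | _, _, .nil => 0
  | u, _, .cons (v := v) _ p => edgeIntegral f g u v + p.integral f g

lemma Walk.integral_append (f g : V → ℤ) (p : Γ.Walk u v) (q : Γ.Walk v w) :
    (p.append q).integral f g = p.integral f g + q.integral f g := by
  induction p with
  | nil => simp [Walk.integral]
  | cons h p ih => simp [Walk.integral, ih, add_assoc]

lemma Walk.integral_eq_zero (f g : V → ℤ) (p : Γ.Walk u v) (h : ∀ x ∈ p.support, g x = 0) :
    p.integral f g = 0 := by
  induction p with
  | nil => rfl
  | cons e p ih =>
    rw [Walk.integral, ih fun x hx ↦ h x (by simp [hx]), edgeIntegral, h _ (by simp),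
      h _ (by simp)]
    simp

/-- Integrals of `f dg` for `1`-Lipschitz functions along closed walks are at most linear in the
length of the walk. -/
def HasLinearIntegrals (Γ : SimpleGraph V) (K : ℕ) : Prop :=
  ∀ f g : V → ℤ, (∀ u v, Γ.Adj u v → |f u - f v| ≤ 1) → (∀ u v, Γ.Adj u v → |g u - g v| ≤ 1) →
    ∀ v (p : Γ.Walk v v), |p.integral f g| ≤ K * p.length

lemma Adj.abs_dist_sub_dist_le_one (hΓ : Γ.Connected) (h : Γ.Adj u v) (y : V) :
    |(Γ.dist y u : ℤ) - Γ.dist y v| ≤ 1 := by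
  have h1 := hΓ.dist_triangle (u := y) (v := u) (w := v)
  have h2 := hΓ.dist_triangle (u := y) (v := v) (w := u)
  rw [dist_eq_one_iff_adj.2 h] at h1
  rw [dist_eq_one_iff_adj.2 h.symm] at h2
  rw [abs_le]
  omega

/-- Both functions grow by 1 along each edge, so the integrand is `2k + 1 = (k + 1)² - k²` and the
sum telescopes. -/
lemma Walk.integral_geodesic_to (p : Γ.Walk u x) {ρ : ℕ} (hp : p.length = Γ.dist x u)
    (hy : Γ.dist y u + p.length = Γ.dist y x) (hΓ : Γ.Connected) (hρ : Γ.dist y x = ρ) :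
    p.integral (fun v ↦ Γ.dist y v) (fun v ↦ max 0 (ρ - Γ.dist x v)) =
      (ρ : ℤ) ^ 2 - Γ.dist y u ^ 2 := by
  induction p with
  | nil => simp [Walk.integral, hρ]
  | @cons u v x e p ih =>
    rw [Walk.length_cons] at hp hy
    have h1 := e.abs_dist_sub_dist_le_one hΓ y
    have h2 := e.abs_dist_sub_dist_le_one hΓ x
    have h3 := Γ.dist_le p
    have h4 := hΓ.dist_triangle (u := y) (v := v) (w := x)
    rw [Γ.dist_comm (u := v)] at h3 h4
    rw [abs_le] at h1 h2
    have h5 : Γ.dist y v = Γ.dist y u + 1 := by omega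
    have h6 : p.length = Γ.dist x v := by omega
    rw [Walk.integral, ih h6 (by omega) hρ, edgeIntegral]
    rw [max_eq_right (by omega), max_eq_right (by omega), ← hp, ← h6, h5]
    push_cast
    ring

/-- Beyond the centre `x` the cone function decreases while the distance from `y` keeps growing, so
the same telescoping occurs with the opposite sign. -/
lemma Walk.integral_geodesic_from (p : Γ.Walk u z) {ρ : ℕ} (hΓ : Γ.Connected)
    (hp : Γ.dist x u + p.length = ρ) (hx : Γ.dist x z = ρ)
    (hy : Γ.dist y u = ρ + Γ.dist x u) (hz : Γ.dist y z = ρ + ρ) :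
    p.integral (fun v ↦ Γ.dist y v) (fun v ↦ max 0 (ρ - Γ.dist x v)) =
      ((ρ + Γ.dist x u : ℕ) : ℤ) ^ 2 - (2 * ρ) ^ 2 := by
  induction p with
  | nil => simp [Walk.integral, hx]; ring
  | @cons u v z e p ih =>
    rw [Walk.length_cons] at hp
    have h1 := e.abs_dist_sub_dist_le_one hΓ y
    have h2 := e.abs_dist_sub_dist_le_one hΓ x
    have h3 := Γ.dist_le p
    have h4 := hΓ.dist_triangle (u := y) (v := v) (w := z)
    have h7 := hΓ.dist_triangle (u := x) (v := v) (w := z)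
    rw [abs_le] at h1 h2
    have h5 : Γ.dist y v = Γ.dist y u + 1 := by omega
    have h6 : Γ.dist x v = Γ.dist x u + 1 := by omega
    rw [Walk.integral, ih (by omega) hx (by omega) hz, edgeIntegral]
    rw [max_eq_right (by omega), max_eq_right (by omega), h5, h6, hy]
    push_cast
    ring

/-- A detour from one end of a geodesic to the other around a ball centred at a point of the
geodesic is at least quadratically long in the radius. -/
lemma HasLinearIntegrals.sq_le_of_detour (hΓ : Γ.Connected) {K ρ : ℕ} (hK : Γ.HasLinearIntegrals K)
    (hx : Γ.IsBetween y x z) (e : Γ.Walk z y) (he : ∀ v ∈ e.support, ρ ≤ Γ.dist x v) :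
    2 * ρ ^ 2 ≤ K * (Γ.dist y z + e.length) := by
  have hyρ := he y (by simp)
  have hzρ := he z (by simp)
  obtain ⟨y', hy', hy'ρ⟩ := exists_isBetween_dist_eq hΓ x y hyρ
  obtain ⟨z', hz', hz'ρ⟩ := exists_isBetween_dist_eq hΓ x z hzρ
  have hxx : Γ.IsBetween y' x z' :=
    (hx.middle_right hΓ hz').middle_left hΓ hy'.symm
  obtain ⟨p₀, hp₀⟩ := hΓ.exists_walk_length_eq_dist y y'
  obtain ⟨p₁, hp₁⟩ := hΓ.exists_walk_length_eq_dist y' x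
  obtain ⟨p₂, hp₂⟩ := hΓ.exists_walk_length_eq_dist x z'
  obtain ⟨p₃, hp₃⟩ := hΓ.exists_walk_length_eq_dist z' z
  have hy'x := Γ.dist_comm (u := y') (v := x)
  have hy'y := Γ.dist_comm (u := y) (v := y')
  have hxy := Γ.dist_comm (u := y) (v := x)
  have hfar : ∀ q : V, ρ ≤ Γ.dist x q → max 0 ((ρ : ℤ) - Γ.dist x q) = 0 := fun q hq ↦ by omega
  have hgeod : ∀ {s t r : V}, Γ.IsBetween x s t → Γ.dist x s = ρ → Γ.IsBetween s r t →
      ρ ≤ Γ.dist x r := by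
    intro s t r h1 h2 h3
    have := hΓ.dist_triangle (u := x) (v := r) (w := t)
    unfold IsBetween at *
    omega
  -- The halves of the geodesic inside the ball contribute `ρ²` and `ρ² - 4ρ²`, in total `-2ρ²`. On
  -- the rest of the closed walk the cone function vanishes.
  have key := hK (fun v ↦ Γ.dist y' v) (fun v ↦ max 0 (ρ - Γ.dist x v))
    (fun u v h ↦ h.abs_dist_sub_dist_le_one hΓ y')
    (fun u v h ↦ by
      have := h.abs_dist_sub_dist_le_one hΓ x
      rw [abs_le] at this ⊢
      omega) y' ((p₁.append p₂).append (p₃.append (e.append p₀)))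
  rw [Walk.integral_append, Walk.integral_append,
    Walk.integral_geodesic_to p₁ (by omega) (by rw [dist_self]; omega) hΓ (by omega),
    Walk.integral_geodesic_from p₂ hΓ (by rw [dist_self]; omega) hz'ρ (by rw [dist_self]; omega)
      (by unfold IsBetween at hxx; omega),
    Walk.integral_eq_zero] at key
  · rw [dist_self, dist_self] at key
    simp only [Walk.length_append] at key
    have h1 : p₁.length + p₂.length + (p₃.length + (e.length + p₀.length)) =
        Γ.dist y z + e.length := by
      unfold IsBetween at *
      have := Γ.dist_comm (u := y') (v := y)
      omega
    have h2 := (abs_le.1 key).1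
    rw [h1] at h2
    push_cast at h2
    zify
    nlinarith
  · intro v hv
    refine hfar v ?_
    rw [Walk.mem_support_append_iff, Walk.mem_support_append_iff] at hv
    rcases hv with hv | hv | hv
    · exact hgeod hz' hz'ρ (isBetween_of_mem_support hΓ _ hp₃ hv)
    · exact he v hv
    · exact hgeod hy' hy'ρ (isBetween_of_mem_support hΓ _ hp₀ hv).symm

lemma Walk.exists_geodesic_support_subset (p : Γ.Walk u v)
    (hp : p.length = Γ.dist u v) {s t : V} (hs : s ∈ p.support) (ht : t ∈ p.support) :
    ∃ q : Γ.Walk s t, q.length = Γ.dist s t ∧ q.support ⊆ p.support := by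
  classical
  have key : ∀ {s t : V} (hs : s ∈ p.support) (_ : t ∈ (p.takeUntil s hs).support),
      ∃ q : Γ.Walk t s, q.length = Γ.dist t s ∧ q.support ⊆ p.support := fun {s t} hs ht ↦
    ⟨(p.takeUntil s hs).dropUntil t ht, length_eq_dist_of_subwalk hp
      (((p.takeUntil s hs).isSubwalk_dropUntil ht).trans (p.isSubwalk_takeUntil hs)),
      fun _ h ↦ p.support_takeUntil_subset_support hs
        ((p.takeUntil s hs).support_dropUntil_subset_support ht h)⟩
  have ht' := ht
  rw [← p.take_spec hs, Walk.mem_support_append_iff] at ht'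
  rcases ht' with ht' | ht'
  · obtain ⟨q, hq, hqs⟩ := key hs ht'
    exact ⟨q.reverse, by rw [Walk.length_reverse, hq, dist_comm], by simpa using hqs⟩
  · exact ⟨(p.dropUntil s hs).takeUntil t ht', length_eq_dist_of_subwalk hp
      (((p.dropUntil s hs).isSubwalk_takeUntil ht').trans (p.isSubwalk_dropUntil hs)),
      fun _ h ↦ p.support_dropUntil_subset_support hs
        ((p.dropUntil s hs).support_takeUntil_subset_support ht' h)⟩

/-- The detour consists of the two escape geodesics and the walk `m`. The constant 6 counts `4 * E`
for the geodesic from `y` to `z` and `E` for each escape. -/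
lemma HasLinearIntegrals.sq_le_of_escapes (hΓ : Γ.Connected) {K E ρ : ℕ}
    (hK : Γ.HasLinearIntegrals K) (hx : Γ.IsBetween y x z) (hxy : Γ.dist x y ≤ 2 * E)
    (hxz : Γ.dist x z ≤ 2 * E) (hz : Γ.dist z u ≤ E) (hy : Γ.dist y w ≤ E)
    (hzu : ∀ v, Γ.IsBetween z v u → ρ ≤ Γ.dist x v) (hyw : ∀ v, Γ.IsBetween y v w → ρ ≤ Γ.dist x v)
    (m : Γ.Walk u w) (hm : ∀ v ∈ m.support, ρ ≤ Γ.dist x v) :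
    2 * ρ ^ 2 ≤ K * (6 * E + m.length) := by
  obtain ⟨p, hp⟩ := hΓ.exists_walk_length_eq_dist z u
  obtain ⟨q, hq⟩ := hΓ.exists_walk_length_eq_dist y w
  refine (hK.sq_le_of_detour hΓ hx (p.append (m.append q.reverse)) fun v hv ↦ ?_).trans
    (Nat.mul_le_mul_left _ ?_)
  · rw [Walk.mem_support_append_iff, Walk.mem_support_append_iff] at hv
    rcases hv with hv | hv | hv
    · exact hzu v (isBetween_of_mem_support hΓ p hp hv)
    · exact hm v hv
    · exact hyw v (isBetween_of_mem_support hΓ q hq (by simpa using hv))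
  · simp only [Walk.length_append, Walk.length_reverse]
    unfold IsBetween at hx
    rw [Γ.dist_comm (u := y) (v := x)] at hx
    omega

/-- Geodesics with a common end point and nearby starting points stay close. -/
lemma HasLinearIntegrals.exists_dist_geodesic_le (hΓ : Γ.Connected) {K B : ℕ}
    (hK : Γ.HasLinearIntegrals K) (hv : Γ.IsBetween a v c) (q : Γ.Walk b c)
    (hq : q.length = Γ.dist b c) (hab : Γ.dist a b ≤ B) :
    ∃ w ∈ q.support, Γ.dist v w ≤ 2 * B + 24 * K := by
  obtain ⟨E, x, hx, hxE, hE⟩ := exists_farthest a c (A := {w | w ∈ q.support}) ⟨c, by simp⟩ hΓ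
  suffices h : E ≤ 2 * B + 24 * K by
    obtain ⟨w, hw, hvw⟩ := hE v hv
    exact ⟨w, hw, hvw.trans h⟩
  by_contra! hlt
  obtain ⟨z, u, hu, hz, hxz, hzu, hzu'⟩ := exists_escape hΓ (B := 0) hx hxE hE
    ⟨c, by simp, by simp⟩ (by omega)
  obtain ⟨y, w, hw, hy, hxy, hyw, hyw'⟩ := exists_escape hΓ (B := B) hx.symm hxE
    (fun y hy ↦ hE y hy.symm) ⟨b, by simp, hab⟩ (by omega)
  obtain ⟨m, hm, hms⟩ := q.exists_geodesic_support_subset hq hu hw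
  have huw : Γ.dist u w ≤ 6 * E := by
    have h1 := hΓ.dist_triangle (u := u) (v := z) (w := w)
    have h2 := hΓ.dist_triangle (u := z) (v := x) (w := w)
    have h3 := hΓ.dist_triangle (u := x) (v := y) (w := w)
    rw [Γ.dist_comm (u := u) (v := z)] at h1
    rw [Γ.dist_comm (u := z) (v := x)] at h2
    omega
  -- The radius drops to `E - B` because the geodesic `q` starts only within `B` of `a`. Since `E ≤
  -- 2 * (E - B)`, the quadratic bound still contradicts the size of `E`.
  have key := hK.sq_le_of_escapes hΓ (E := E) (ρ := E - B)
    ((hx.middle_right hΓ hz).middle_left hΓ hy.symm) hxy hxz hzu hyw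
    (fun v hv ↦ by have := hzu' v hv; omega) (fun v hv ↦ by have := hyw' v hv; omega) m
    (fun v hv ↦ by have := hxE v (hms hv); omega)
  have h1 : K * (6 * E + m.length) ≤ K * (12 * E) := Nat.mul_le_mul_left _ (by omega)
  obtain ⟨ρ, rfl⟩ : ∃ ρ, E = ρ + B := ⟨E - B, by omega⟩
  rw [Nat.add_sub_cancel] at key
  have h2 : B ≤ ρ := by omega
  nlinarith

/-- Two geodesics that end at the same vertex and start at nearby vertices can be joined by a short
walk that keeps away from a vertex `x`, if both geodesics do so. -/
lemma HasLinearIntegrals.exists_crossing (hΓ : Γ.Connected) {K E : ℕ}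
    (hK : Γ.HasLinearIntegrals K) (hE : 24 * K ≤ E) (q : Γ.Walk u c) (hq : q.length = Γ.dist u c)
    (r : Γ.Walk w c) (hr : r.length = Γ.dist w c) (hqx : ∀ v ∈ q.support, E ≤ Γ.dist x v)
    (hrx : ∀ v ∈ r.support, E ≤ Γ.dist x v) (huw : Γ.dist u w ≤ 6 * E)
    (hxu : Γ.dist x u ≤ 3 * E) :
    ∃ m : Γ.Walk u w, m.length ≤ 66 * E ∧ ∀ v ∈ m.support, E ≤ Γ.dist x v := by
  have hwu := Γ.dist_comm (u := u) (v := w)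
  -- If `c` is near, cross at `c`. Otherwise cross at the point `t` at distance `17 * E` from `u`:
  -- it is at least `14 * E` away from `x`, and the crossing has length at most `12 * E + 24 * K ≤
  -- 13 * E`, so it stays `E` away from `x`.
  by_cases huc : Γ.dist u c ≤ 17 * E
  · refine ⟨q.append r.reverse, ?_, fun v hv ↦ ?_⟩
    · have := hΓ.dist_triangle (u := w) (v := u) (w := c)
      rw [Walk.length_append, Walk.length_reverse]
      omega
    · rw [Walk.mem_support_append_iff, Walk.support_reverse, List.mem_reverse] at hv
      exact hv.elim (hqx v) (hrx v)
  · have ht := (isBetween_getVert hΓ q hq (k := 17 * E) (by omega))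
    have htq : q.getVert (17 * E) ∈ q.support := q.getVert_mem_support _
    generalize q.getVert (17 * E) = t at ht htq
    obtain ⟨t', ht', htt'⟩ := hK.exists_dist_geodesic_le hΓ ht.1 r hr huw
    obtain ⟨q', hq', hqs⟩ := q.exists_geodesic_support_subset hq q.start_mem_support htq
    obtain ⟨r', hr', hrs⟩ := r.exists_geodesic_support_subset hr ht' r.start_mem_support
    obtain ⟨s, hs⟩ := hΓ.exists_walk_length_eq_dist t t'
    have h1 := hΓ.dist_triangle (u := t') (v := t) (w := w)
    have h2 := hΓ.dist_triangle (u := t) (v := u) (w := w)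
    rw [Γ.dist_comm (u := t') (v := t)] at h1
    rw [Γ.dist_comm (u := t) (v := u)] at h2
    refine ⟨q'.append (s.append r'), ?_, fun v hv ↦ ?_⟩
    · simp only [Walk.length_append]
      omega
    · rw [Walk.mem_support_append_iff, Walk.mem_support_append_iff] at hv
      rcases hv with hv | hv | hv
      · exact hqx v (hqs hv)
      · have h3 := isBetween_of_mem_support hΓ s hs hv
        have h4 := hΓ.dist_triangle (u := u) (v := x) (w := t)
        have h5 := hΓ.dist_triangle (u := x) (v := v) (w := t)
        rw [Γ.dist_comm (u := u) (v := x)] at h4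
        rw [Γ.dist_comm (u := v) (v := t)] at h5
        unfold IsBetween at h3
        omega
      · exact hrx v (hrs hv)

/-- Linear bounds for integrals imply that geodesic triangles are thin. -/
theorem HasLinearIntegrals.isRipsHyperbolic (hΓ : Γ.Connected) {K : ℕ}
    (hK : Γ.HasLinearIntegrals K) : Γ.IsRipsHyperbolic (36 * K : ℕ) := by
  intro a b c p q r hp hq hr v hv
  have hv := isBetween_of_mem_support hΓ p hp hv
  obtain ⟨E, x, hx, hxE, hE⟩ := exists_farthest a b
    (A := {w | w ∈ q.support ∨ w ∈ r.support}) ⟨c, by simp⟩ hΓ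
  suffices h : E ≤ 36 * K by
    obtain ⟨w, hw, hvw⟩ := hE v hv
    exact ⟨w, hw, by exact_mod_cast hvw.trans h⟩
  by_contra! hlt
  obtain ⟨z, u, hu, hz, hxz, hzu, hzu'⟩ := exists_escape hΓ (B := 0) hx hxE hE
    ⟨b, by simp, by simp⟩ (by omega)
  obtain ⟨y, w, hw, hy, hxy, hyw, hyw'⟩ := exists_escape hΓ (B := 0) hx.symm hxE
    (fun y hy ↦ hE y hy.symm) ⟨a, by simp, by simp⟩ (by omega)
  have hxu : Γ.dist x u ≤ 3 * E := by
    have := hΓ.dist_triangle (u := x) (v := z) (w := u)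
    omega
  have huw : Γ.dist u w ≤ 6 * E := by
    have h1 := hΓ.dist_triangle (u := u) (v := x) (w := w)
    have h3 := hΓ.dist_triangle (u := x) (v := y) (w := w)
    rw [Γ.dist_comm (u := u) (v := x)] at h1
    omega
  obtain ⟨m, hm, hmx⟩ : ∃ m : Γ.Walk u w, m.length ≤ 66 * E ∧ ∀ v ∈ m.support, E ≤ Γ.dist x v := by
    rcases hu with hu | hu <;> rcases hw with hw | hw
    · obtain ⟨m, hm, hms⟩ := q.exists_geodesic_support_subset hq hu hw
      exact ⟨m, by omega, fun v hv ↦ hxE v (Or.inl (hms hv))⟩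
    · obtain ⟨q', hq', hqs⟩ := q.exists_geodesic_support_subset hq hu q.end_mem_support
      obtain ⟨r', hr', hrs⟩ := r.exists_geodesic_support_subset hr hw r.start_mem_support
      exact hK.exists_crossing hΓ (by omega) q' hq' r' hr' (fun v hv ↦ hxE v (Or.inl (hqs hv)))
        (fun v hv ↦ hxE v (Or.inr (hrs hv))) huw hxu
    · obtain ⟨q', hq', hqs⟩ := q.exists_geodesic_support_subset hq hw q.end_mem_support
      obtain ⟨r', hr', hrs⟩ := r.exists_geodesic_support_subset hr hu r.start_mem_support
      exact hK.exists_crossing hΓ (by omega) r' hr' q' hq' (fun v hv ↦ hxE v (Or.inr (hrs hv)))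
        (fun v hv ↦ hxE v (Or.inl (hqs hv))) huw hxu
    · obtain ⟨m, hm, hms⟩ := r.exists_geodesic_support_subset hr hu hw
      exact ⟨m, by omega, fun v hv ↦ hxE v (Or.inr (hms hv))⟩
  -- This reads `2 * E² ≤ K * (6 * E + 66 * E)`, whence the constant 36.
  have key := hK.sq_le_of_escapes hΓ (E := E) (ρ := E)
    ((hx.middle_right hΓ hz).middle_left hΓ hy.symm) hxy hxz hzu hyw
    (fun v hv ↦ by have := hzu' v hv; omega) (fun v hv ↦ by have := hyw' v hv; omega) m hmx
  have h1 : K * (6 * E + m.length) ≤ K * (72 * E) := Nat.mul_le_mul_left _ (by omega)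
  nlinarith

end SimpleGraph

/-! ### Distances in Cayley graphs. -/

namespace SimpleGraph

variable {G : Type*} [Group G] {S : Set G}

lemma mulCayley_dist_mul_left (hS : (mulCayley S).Connected) (g u v : G) :
    (mulCayley S).dist (g * u) (g * v) = (mulCayley S).dist u v := by
  have key : ∀ g u v : G, (mulCayley S).dist (g * u) (g * v) ≤ (mulCayley S).dist u v := by
    intro g u v
    obtain ⟨p, hp⟩ := hS.exists_walk_length_eq_dist u v
    have := (mulCayley S).dist_le
      (p.map (⟨fun h ↦ g * h, fun h ↦ mulCayley_adj_mul_iff_right.2 h⟩ :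
        mulCayley S →g mulCayley S))
    rw [Walk.length_map, hp] at this
    exact this
  refine le_antisymm (key g u v) ?_
  simpa using key g⁻¹ (g * u) (g * v)

lemma mulCayley_dist_eq (hS : (mulCayley S).Connected) (u v : G) :
    (mulCayley S).dist u v = (mulCayley S).dist 1 (u⁻¹ * v) := by
  rw [← mulCayley_dist_mul_left hS u⁻¹, inv_mul_cancel]

lemma mulCayley_connected (hS : Subgroup.closure S = ⊤) : (mulCayley S).Connected := by
  have key : ∀ g ∈ Subgroup.closure S, ∀ h, (mulCayley S).Reachable h (h * g) := by
    intro g hg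
    induction hg using Subgroup.closure_induction with
    | mem s hs =>
      intro h
      by_cases hh : h = h * s
      · rw [← hh]
      · exact ((mulCayley_adj' S _ _).2 ⟨hh, s, hs, Or.inl rfl⟩).reachable
    | one => simp
    | mul s t _ _ hs ht =>
      intro h
      rw [← mul_assoc]
      exact (hs h).trans (ht _)
    | inv s _ hs =>
      intro h
      simpa using (hs (h * s⁻¹)).symm
  refine ⟨fun u v ↦ ?_⟩
  simpa using key (u⁻¹ * v) (by rw [hS]; trivial) u

lemma Connected.abs_sub_le_dist {V : Type*} {Γ : SimpleGraph V} (hΓ : Γ.Connected) {f : V → ℤ}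
    (hf : ∀ u v, Γ.Adj u v → |f u - f v| ≤ 1) (u v : V) : |f u - f v| ≤ Γ.dist u v := by
  obtain ⟨p, hp⟩ := hΓ.exists_walk_length_eq_dist u v
  rw [← hp]
  clear hp
  induction p with
  | nil => simp
  | @cons u v w h p ih =>
    have h1 := hf _ _ h
    rw [Walk.length_cons]
    rw [abs_le] at *
    push_cast
    omega

end SimpleGraph

/-! ### Integrals along words, and fillings by relators. -/

section Words

open SimpleGraph FreeGroup

variable {G : Type*} [Group G] {n : ℕ} {φ : FreeGroup (Fin n) →* G} {f g : G → ℤ}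

/-- The integral of `f dg`, up to the factor `2`, along the path in the Cayley graph that starts at
a given vertex and is labeled by a given word. -/
def wordIntegral (φ : FreeGroup (Fin n) →* G) (f g : G → ℤ) : G → List (Fin n × Bool) → ℤ
  | _, [] => 0
  | h, s :: L => edgeIntegral f g h (h * φ (mk [s])) + wordIntegral φ f g (h * φ (mk [s])) L

lemma wordIntegral_append (h : G) (L L' : List (Fin n × Bool)) :
    wordIntegral φ f g h (L ++ L') =
      wordIntegral φ f g h L + wordIntegral φ f g (h * φ (mk L)) L' := by
  induction L generalizing h with
  | nil => simp [wordIntegral, ← one_eq_mk]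
  | cons s L ih =>
    rw [List.cons_append, wordIntegral, ih, wordIntegral, add_assoc, mul_assoc, ← _root_.map_mul,
      mul_mk, List.singleton_append]

/-- `edgeIntegral` changes sign when the edge is reversed, so backtracking contributes nothing.
Hence the integral is defined on the free group. -/
lemma wordIntegral_reduce (h : G) (L : List (Fin n × Bool)) :
    wordIntegral φ f g h (reduce L) = wordIntegral φ f g h L := by
  have key : ∀ L L' : List (Fin n × Bool), Red.Step L L' →
      wordIntegral φ f g h L' = wordIntegral φ f g h L := by
    rintro _ _ (@⟨L₁, L₂, i, b⟩)
    have h1 : φ (mk [(i, b)]) * φ (mk [(i, !b)]) = 1 := by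
      rw [← _root_.map_mul, mul_mk, List.singleton_append, ← _root_.map_one φ, one_eq_mk]
      exact congrArg φ (Quot.sound (by simp))
    rw [wordIntegral_append, wordIntegral_append, wordIntegral, wordIntegral,
      mul_assoc _ (φ (mk [(i, b)])), h1, mul_one]
    simp only [edgeIntegral]
    ring
  have hred : Red L (reduce L) := reduce.red
  generalize reduce L = L' at hred
  induction hred with
  | refl => rfl
  | tail _ hs ih => rw [key _ _ hs, ih]

/-- The integral of `f dg`, up to the factor `2`, along a path labeled by an element of the free
group. -/
def freeIntegral (φ : FreeGroup (Fin n) →* G) (f g : G → ℤ) (h : G) (w : FreeGroup (Fin n)) : ℤ :=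
  wordIntegral φ f g h w.toWord

lemma freeIntegral_mk (h : G) (L : List (Fin n × Bool)) :
    freeIntegral φ f g h (mk L) = wordIntegral φ f g h L := by
  rw [freeIntegral, toWord_mk, wordIntegral_reduce]

lemma freeIntegral_mul (h : G) (v w : FreeGroup (Fin n)) :
    freeIntegral φ f g h (v * w) = freeIntegral φ f g h v + freeIntegral φ f g (h * φ v) w := by
  rw [freeIntegral, toWord_mul, wordIntegral_reduce, wordIntegral_append, mk_toWord]
  rfl

lemma freeIntegral_one (h : G) : freeIntegral φ f g h 1 = 0 := by
  simp [freeIntegral, wordIntegral]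

lemma freeIntegral_conj (h : G) (s r : FreeGroup (Fin n)) (hr : φ r = 1) :
    freeIntegral φ f g h (s * r * s⁻¹) = freeIntegral φ f g (h * φ s) r := by
  have h1 := freeIntegral_mul (φ := φ) (f := f) (g := g) h s s⁻¹
  rw [mul_inv_cancel, freeIntegral_one] at h1
  rw [freeIntegral_mul, freeIntegral_mul, _root_.map_mul, hr, mul_one]
  omega

lemma freeIntegral_inv (h : G) (r : FreeGroup (Fin n)) (hr : φ r = 1) :
    freeIntegral φ f g h r⁻¹ = -freeIntegral φ f g h r := by
  have h1 := freeIntegral_mul (φ := φ) (f := f) (g := g) h r r⁻¹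
  rw [mul_inv_cancel, freeIntegral_one, hr, mul_one] at h1
  omega

lemma abs_letter_sub_le {μ : ℕ} (hf : ∀ h i, |f (h * φ (of i)) - f h| ≤ μ) (h : G)
    (s : Fin n × Bool) : |f (h * φ (mk [s])) - f h| ≤ μ := by
  obtain ⟨i, _ | _⟩ := s
  · have := hf (h * φ (mk [(i, false)])) i
    have h1 : (mk [(i, false)] : FreeGroup (Fin n)) = (of i)⁻¹ := rfl
    rw [h1] at this ⊢
    rw [_root_.map_inv, inv_mul_cancel_right] at this
    rwa [_root_.map_inv, abs_sub_comm]
  · exact hf h i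

/-- The integral is compared with that of the constant `c`. Both `c` and the bound `M` on the
deviation of `f` from `c` are independent of the base point, so that they stay fixed in the
induction while `h` moves. -/
lemma abs_wordIntegral_sub_le_mul {μ : ℕ} (hf : ∀ h i, |f (h * φ (of i)) - f h| ≤ μ)
    (hg : ∀ h i, |g (h * φ (of i)) - g h| ≤ μ) (c M : ℤ) (h : G) (L : List (Fin n × Bool))
    (hM : |f h - c| + L.length * μ ≤ M) :
    |wordIntegral φ f g h L - 2 * c * (g (h * φ (mk L)) - g h)| ≤ L.length * (2 * M * μ) := by
  induction L generalizing h with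
  | nil => simp [wordIntegral, ← one_eq_mk]
  | cons s L ih =>
    have h1 := abs_letter_sub_le hf h s
    have h2 := abs_letter_sub_le hg h s
    have h3 : (mk (s :: L) : FreeGroup (Fin n)) = mk [s] * mk L := rfl
    rw [List.length_cons] at hM ⊢
    rw [wordIntegral, h3, _root_.map_mul, ← mul_assoc]
    set h' := h * φ (mk [s])
    push_cast at hM ⊢
    have h0 : (0 : ℤ) ≤ L.length * μ := by positivity
    have h4 : |f h' - c| ≤ |f h - c| + μ := by
      have := abs_add_le (f h' - f h) (f h - c)
      rw [sub_add_sub_cancel] at this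
      linarith
    have h5 := ih h' (by linarith)
    have h6 : |(f h - c) + (f h' - c)| ≤ 2 * M := by
      have := abs_add_le (f h - c) (f h' - c)
      linarith [(by positivity : (0 : ℤ) ≤ μ)]
    have h7 : |((f h - c) + (f h' - c)) * (g h' - g h)| ≤ 2 * M * μ := by
      rw [abs_mul]
      exact mul_le_mul h6 h2 (abs_nonneg _) ((abs_nonneg _).trans h6)
    have h8 := abs_add_le (((f h - c) + (f h' - c)) * (g h' - g h))
      (wordIntegral φ f g h' L - 2 * c * (g (h' * φ (mk L)) - g h'))
    have h9 : edgeIntegral f g h h' + wordIntegral φ f g h' L -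
        2 * c * (g (h' * φ (mk L)) - g h) = ((f h - c) + (f h' - c)) * (g h' - g h) +
        (wordIntegral φ f g h' L - 2 * c * (g (h' * φ (mk L)) - g h')) := by
      rw [edgeIntegral]
      ring
    rw [h9]
    linarith

lemma abs_wordIntegral_sub_le {μ : ℕ} (hf : ∀ h i, |f (h * φ (of i)) - f h| ≤ μ)
    (hg : ∀ h i, |g (h * φ (of i)) - g h| ≤ μ) (h : G) (L : List (Fin n × Bool)) :
    |wordIntegral φ f g h L - 2 * f h * (g (h * φ (mk L)) - g h)| ≤
      2 * (L.length * μ : ℕ) ^ 2 := by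
  refine (abs_wordIntegral_sub_le_mul hf hg (f h) (L.length * μ) h L (by simp)).trans (le_of_eq ?_)
  push_cast
  ring

/-- `w` is a product of at most `N` conjugates of elements of `R` and of their inverses. -/
def HasAreaLE (R : Set (FreeGroup (Fin n))) (w : FreeGroup (Fin n)) (N : ℕ) : Prop :=
  ∃ l : List (FreeGroup (Fin n)),
    (∀ y ∈ l, ∃ s, ∃ r ∈ R, y = s * r * s⁻¹ ∨ y = s * r⁻¹ * s⁻¹) ∧ l.prod = w ∧ l.length ≤ N

namespace HasAreaLE

variable {R R' : Set (FreeGroup (Fin n))} {v w : FreeGroup (Fin n)} {M N : ℕ}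

lemma relatorArea_le (h : HasAreaLE R w N) : relatorArea R w ≤ N := by
  obtain ⟨l, hl, hw, hN⟩ := h
  exact (iInf₂_le l ⟨hl, hw⟩).trans (by exact_mod_cast hN)

lemma one : HasAreaLE R 1 N := ⟨[], by simp, by simp, by simp⟩

lemma mono (h : HasAreaLE R w N) (hNM : N ≤ M) : HasAreaLE R w M := by
  obtain ⟨l, hl, hw, hN⟩ := h
  exact ⟨l, hl, hw, hN.trans hNM⟩

lemma mul (hv : HasAreaLE R v M) (hw : HasAreaLE R w N) : HasAreaLE R (v * w) (M + N) := by
  obtain ⟨l, hl, rfl, hM⟩ := hv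
  obtain ⟨l', hl', rfl, hN⟩ := hw
  refine ⟨l ++ l', fun y hy ↦ ?_, by simp, by simp; omega⟩
  exact (List.mem_append.1 hy).elim (hl y) (hl' y)

lemma conj (hw : HasAreaLE R w N) (s : FreeGroup (Fin n)) : HasAreaLE R (s * w * s⁻¹) N := by
  obtain ⟨l, hl, rfl, hN⟩ := hw
  refine ⟨l.map (MulAut.conj s), fun y hy ↦ ?_, ?_, by simpa⟩
  · obtain ⟨z, hz, rfl⟩ := List.mem_map.1 hy
    obtain ⟨t, r, hr, rfl | rfl⟩ := hl z hz
    · exact ⟨s * t, r, hr, Or.inl (by simp [mul_assoc])⟩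
    · exact ⟨s * t, r, hr, Or.inr (by simp [mul_assoc])⟩
  · rw [← map_list_prod]
    simp

lemma inv (hw : HasAreaLE R w N) : HasAreaLE R w⁻¹ N := by
  obtain ⟨l, hl, rfl, hN⟩ := hw
  refine ⟨(l.map (·⁻¹)).reverse, fun y hy ↦ ?_, (List.prod_inv_reverse l).symm, by simpa⟩
  obtain ⟨z, hz, rfl⟩ := List.mem_map.1 (List.mem_reverse.1 hy)
  obtain ⟨t, r, hr, rfl | rfl⟩ := hl z hz
  · exact ⟨t, r, hr, Or.inr (by simp [mul_assoc])⟩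
  · exact ⟨t, r, hr, Or.inl (by simp [mul_assoc])⟩

lemma of_mem {r : FreeGroup (Fin n)} (hr : r ∈ R) : HasAreaLE R r 1 :=
  ⟨[r], by simpa using ⟨1, r, hr, Or.inl (by simp)⟩, by simp, by simp⟩

lemma mem_normalClosure (hw : HasAreaLE R w N) : w ∈ Subgroup.normalClosure R := by
  obtain ⟨l, hl, rfl, -⟩ := hw
  refine Subgroup.list_prod_mem _ fun y hy ↦ ?_
  obtain ⟨t, r, hr, rfl | rfl⟩ := hl y hy
  · exact Subgroup.normalClosure_normal.conj_mem _ (Subgroup.subset_normalClosure hr) t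
  · exact Subgroup.normalClosure_normal.conj_mem _
      (inv_mem (Subgroup.subset_normalClosure hr)) t

lemma trans (hw : HasAreaLE R' w N) (h : ∀ r ∈ R', HasAreaLE R r M) :
    HasAreaLE R w (M * N) := by
  obtain ⟨l, hl, rfl, hN⟩ := hw
  refine mono (N := M * l.length) ?_ (Nat.mul_le_mul_left _ hN)
  clear hN
  induction l with
  | nil => exact one
  | cons y l ih =>
    have hy : HasAreaLE R y M := by
      obtain ⟨t, r, hr, rfl | rfl⟩ := hl y (by simp)
      · exact (h r hr).conj t
      · exact (h r hr).inv.conj t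
    rw [List.prod_cons, List.length_cons]
    exact (hy.mul (ih fun z hz ↦ hl z (by simp [hz]))).mono (by rw [mul_add]; omega)

/-- A filling of a word bounds the integrals along the word. -/
lemma abs_freeIntegral_le {μ m : ℕ} (hw : HasAreaLE R w N)
    (hf : ∀ h i, |f (h * φ (of i)) - f h| ≤ μ) (hg : ∀ h i, |g (h * φ (of i)) - g h| ≤ μ)
    (hR : ∀ r ∈ R, φ r = 1 ∧ r.norm ≤ m) (h : G) :
    |freeIntegral φ f g h w| ≤ (N * (2 * (m * μ) ^ 2) : ℕ) := by
  obtain ⟨l, hl, rfl, hN⟩ := hw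
  refine le_trans ?_ (Int.ofNat_le.2 (Nat.mul_le_mul_right _ hN))
  have hr : ∀ r ∈ R, ∀ h, |freeIntegral φ f g h r| ≤ (2 * (m * μ) ^ 2 : ℕ) := by
    intro r hr h
    have h1 := abs_wordIntegral_sub_le hf hg h r.toWord
    rw [mk_toWord, (hR r hr).1, mul_one, sub_self, mul_zero, sub_zero] at h1
    refine h1.trans ?_
    have h2 : r.toWord.length * μ ≤ m * μ := Nat.mul_le_mul_right _ (hR r hr).2
    exact_mod_cast Nat.mul_le_mul_left 2 (Nat.pow_le_pow_left h2 2)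
  clear hN
  induction l with
  | nil => simp [freeIntegral_one]
  | cons y l ih =>
    have hy : φ y = 1 ∧ |freeIntegral φ f g h y| ≤ (2 * (m * μ) ^ 2 : ℕ) := by
      obtain ⟨t, r, hrR, rfl | rfl⟩ := hl y (by simp)
      · rw [freeIntegral_conj _ _ _ (hR r hrR).1]
        exact ⟨by simp [(hR r hrR).1], hr r hrR _⟩
      · rw [freeIntegral_conj _ _ _ (by simp [(hR r hrR).1]), freeIntegral_inv _ _ (hR r hrR).1,
          abs_neg]
        exact ⟨by simp [(hR r hrR).1], hr r hrR _⟩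
    have h1 := ih fun z hz ↦ hl z (by simp [hz])
    rw [List.prod_cons, freeIntegral_mul, hy.1, mul_one, List.length_cons, add_mul, one_mul]
    refine (abs_add_le _ _).trans ?_
    rw [Nat.cast_add]
    linarith [hy.2]

end HasAreaLE

/-- Groups with a linear isoperimetric inequality satisfy linear bounds for integrals along closed
walks in all their Cayley graphs. -/
theorem exists_hasLinearIntegrals (hφ : Function.Surjective φ) {R : Set (FreeGroup (Fin n))}
    (hR : R.Finite) (hRφ : ∀ r ∈ R, φ r = 1) (harea : ∀ w, φ w = 1 → HasAreaLE R w w.norm)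
    {S : Set G} (hS : S.Finite) (hS' : Subgroup.closure S = ⊤) :
    ∃ K, (mulCayley S).HasLinearIntegrals K := by
  have hΓ := mulCayley_connected hS'
  obtain ⟨m, hm⟩ : ∃ m, ∀ r ∈ R, r.norm ≤ m := by
    obtain ⟨m, hm⟩ := (hR.image FreeGroup.norm).bddAbove
    exact ⟨m, fun r hr ↦ hm ⟨r, hr, rfl⟩⟩
  obtain ⟨μ, hμ⟩ : ∃ μ, ∀ i, (mulCayley S).dist 1 (φ (of i)) ≤ μ := by
    obtain ⟨μ, hμ⟩ := (Set.finite_range fun i ↦ (mulCayley S).dist 1 (φ (of i))).bddAbove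
    exact ⟨μ, fun i ↦ hμ ⟨i, rfl⟩⟩
  choose σ hσ using hφ
  obtain ⟨M, hM⟩ : ∃ M, ∀ s ∈ S ∪ S⁻¹, (σ s).norm ≤ M := by
    obtain ⟨M, hM⟩ := ((hS.union hS.inv).image fun s ↦ (σ s).norm).bddAbove
    exact ⟨M, fun s hs ↦ hM ⟨s, hs, rfl⟩⟩
  -- The first summand comes from filling a word of length at most `M * p.length`; the second is the
  -- error, per edge, of replacing the walk by that word.
  refine ⟨M * (2 * (m * μ) ^ 2) + (1 + 2 * (M * μ) ^ 2), fun f g hf hg v p ↦ ?_⟩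
  have hlip : ∀ f : G → ℤ, (∀ u v, (mulCayley S).Adj u v → |f u - f v| ≤ 1) →
      ∀ h i, |f (h * φ (of i)) - f h| ≤ μ := by
    intro f hf h i
    rw [abs_sub_comm]
    refine (hΓ.abs_sub_le_dist hf _ _).trans ?_
    rw [mulCayley_dist_eq hΓ, inv_mul_cancel_left]
    exact_mod_cast hμ i
  have hfφ := hlip f hf
  have hgφ := hlip g hg
  have key : ∀ {u v : G} (p : (mulCayley S).Walk u v), ∃ L : List (Fin n × Bool),
      L.length ≤ M * p.length ∧ u * φ (mk L) = v ∧
      |p.integral f g - wordIntegral φ f g u L| ≤ (p.length * (1 + 2 * (M * μ) ^ 2) : ℕ) := by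
    intro u v p
    induction p with
    | nil => exact ⟨[], by simp, by simp [← one_eq_mk], by simp [Walk.integral, wordIntegral]⟩
    | @cons u v w h p ih =>
      obtain ⟨L, hL, hLw, hI⟩ := ih
      have hs : u⁻¹ * v ∈ S ∪ S⁻¹ := by
        have := ((mulCayley_adj S u v).1 h).2
        simpa using this
      have hv : u * φ (mk (σ (u⁻¹ * v)).toWord) = v := by rw [mk_toWord, hσ]; simp
      refine ⟨(σ (u⁻¹ * v)).toWord ++ L, ?_, ?_, ?_⟩
      · have := hM _ hs
        rw [List.length_append, Walk.length_cons, mul_add]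
        change (σ (u⁻¹ * v)).norm + _ ≤ _
        omega
      · rw [← mul_mk, _root_.map_mul, ← mul_assoc, hv, hLw]
      -- The edge and the word replacing it have the same ends, and both integrals are compared with
      -- `2 * f u * (g v - g u)`.
      · have h1 := abs_wordIntegral_sub_le hfφ hgφ u (σ (u⁻¹ * v)).toWord
        rw [wordIntegral_append, Walk.integral, Walk.length_cons, hv]
        rw [hv] at h1
        have h2 : ((((σ (u⁻¹ * v)).toWord.length * μ : ℕ) : ℤ)) ^ 2 ≤ ((M * μ : ℕ) : ℤ) ^ 2 := by
          exact_mod_cast Nat.pow_le_pow_left (Nat.mul_le_mul_right _ (hM _ hs)) 2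
        have h3 : |edgeIntegral f g u v - 2 * f u * (g v - g u)| ≤ 1 := by
          rw [edgeIntegral, show (f u + f v) * (g v - g u) - 2 * f u * (g v - g u) =
            (f u - f v) * (g u - g v) by ring, abs_mul]
          exact mul_le_one₀ (hf _ _ h) (abs_nonneg _) (hg _ _ h)
        rw [abs_le] at h1 h3 hI ⊢
        push_cast at h1 h2 h3 hI ⊢
        constructor <;> linarith
  obtain ⟨L, hL, hLv, hI⟩ := key p
  have hL1 : φ (mk L) = 1 := by simpa using hLv
  have h1 := (harea _ hL1).abs_freeIntegral_le hfφ hgφ (fun r hr ↦ ⟨hRφ r hr, hm r hr⟩) v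
  rw [freeIntegral_mk] at h1
  have h2 : ((norm (mk L) * (2 * (m * μ) ^ 2) : ℕ) : ℤ) ≤
      (M * p.length * (2 * (m * μ) ^ 2) : ℕ) := by
    exact_mod_cast Nat.mul_le_mul_right _ (norm_mk_le.trans hL)
  rw [abs_le] at h1 hI ⊢
  push_cast at h1 h2 hI ⊢
  constructor <;> linarith

end Words

/-! ### Dehn's algorithm and short relators. -/

section Dehn

open SimpleGraph FreeGroup

variable {G : Type*} [Group G] {n : ℕ} {φ : FreeGroup (Fin n) →* G} {R : Set (FreeGroup (Fin n))}

lemma List.IsRotated.exists_mk_eq_conj {L L' : List (Fin n × Bool)} (h : L ~r L') :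
    ∃ a : FreeGroup (Fin n), FreeGroup.mk L = a * FreeGroup.mk L' * a⁻¹ := by
  obtain ⟨k, hk, rfl⟩ := List.isRotated_iff_mod.1 h
  refine ⟨FreeGroup.mk (L.take k), ?_⟩
  rw [List.rotate_eq_drop_append_take hk, ← mul_mk, mul_assoc, mul_inv_cancel_right, mul_mk,
    List.take_append_drop]

lemma DehnStep.exists_mk_eq {w w₁ : List (Fin n × Bool)} (h : DehnStep R w w₁) :
    IsReduced w₁ ∧ w₁.length < w.length ∧ ∃ a s, ∃ r ∈ R,
      FreeGroup.mk w = a * (s * r * s⁻¹ * FreeGroup.mk w₁) * a⁻¹ ∨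
      FreeGroup.mk w = a * (s * r⁻¹ * s⁻¹ * FreeGroup.mk w₁) * a⁻¹ := by
  obtain ⟨r, hr, u, v, t, huv, hlt, hut, rfl⟩ := h
  refine ⟨?_, ?_, ?_⟩
  · rw [← toWord_mk]
    exact isReduced_toWord
  · have h1 := hut.perm.length_eq
    have h2 := norm_mk_le (L₁ := invRev v ++ t)
    rw [FreeGroup.norm, toWord_mk] at h2
    rw [List.length_append, invRev_length] at h2
    rw [List.length_append] at h1
    omega
  · obtain ⟨a, ha⟩ := hut.symm.exists_mk_eq_conj
    have h1 : (mk u * mk t : FreeGroup (Fin n)) = mk (u ++ v) * mk (reduce (invRev v ++ t)) := by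
      rw [reduce.self, ← mul_mk, ← mul_mk, ← inv_mk]
      group
    rw [ha, ← mul_mk, h1]
    rcases huv with huv | huv
    · obtain ⟨s, hs⟩ := huv.exists_mk_eq_conj
      rw [mk_toWord] at hs
      exact ⟨a, s, r, hr, Or.inl (by rw [hs])⟩
    · obtain ⟨s, hs⟩ := huv.exists_mk_eq_conj
      rw [mk_toWord] at hs
      exact ⟨a, s, r, hr, Or.inr (by rw [hs])⟩

lemma DehnStep.map_eq_one_iff {w w₁ : List (Fin n × Bool)} (h : DehnStep R w w₁)
    (hR : ∀ r ∈ R, φ r = 1) : φ (FreeGroup.mk w) = 1 ↔ φ (FreeGroup.mk w₁) = 1 := by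
  obtain ⟨-, -, a, s, r, hr, h | h⟩ := h.exists_mk_eq <;> simp [h, hR r hr]

lemma DehnStep.hasAreaLE {w w₁ : List (Fin n × Bool)} {N : ℕ} (h : DehnStep R w w₁)
    (hN : HasAreaLE R (FreeGroup.mk w₁) N) : HasAreaLE R (FreeGroup.mk w) (N + 1) := by
  obtain ⟨-, -, a, s, r, hr, h | h⟩ := h.exists_mk_eq <;> rw [h, add_comm]
  · exact (((HasAreaLE.of_mem hr).conj s).mul hN).conj a
  · exact (((HasAreaLE.of_mem hr).inv.conj s).mul hN).conj a

/-- Every non-empty reduced word that represents `1` can be shortened by a step of the Dehn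
algorithm. -/
def HasDehnSteps (φ : FreeGroup (Fin n) →* G) (R : Set (FreeGroup (Fin n))) : Prop :=
  ∀ w : List (Fin n × Bool), IsReduced w → w ≠ [] → φ (FreeGroup.mk w) = 1 → ∃ w₁, DehnStep R w w₁

lemma IsDehnPresentation.hasDehnSteps (h : IsDehnPresentation φ R) : HasDehnSteps φ R := by
  intro w hw hne hw1
  by_contra! hno
  exact hne ((h.algorithm_works w w hw .refl hno).2 hw1)

lemma IsFinitePresentation.map_eq_one (h : IsFinitePresentation φ R) {r : FreeGroup (Fin n)}
    (hr : r ∈ R) : φ r = 1 := by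
  rw [← MonoidHom.mem_ker, ← h.normalClosure_eq]
  exact Subgroup.subset_normalClosure hr

/-- Each step of the algorithm splits off one conjugate of a relator or of its inverse and removes
at least one letter. -/
lemma HasDehnSteps.hasAreaLE_norm (h : HasDehnSteps φ R) (hR : ∀ r ∈ R, φ r = 1)
    (w : FreeGroup (Fin n)) (hw : φ w = 1) : HasAreaLE R w w.norm := by
  have key : ∀ (m : ℕ) (w : List (Fin n × Bool)), IsReduced w → w.length = m → φ (mk w) = 1 →
      HasAreaLE R (mk w) m := by
    intro m
    induction m using Nat.strong_induction_on with
    | _ m ih =>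
    intro w hw hm hw1
    rcases eq_or_ne w [] with rfl | hne
    · rw [← one_eq_mk]
      exact HasAreaLE.one
    · obtain ⟨w₁, h1⟩ := h w hw hne hw1
      obtain ⟨h2, h3, -⟩ := h1.exists_mk_eq
      exact (h1.hasAreaLE (ih _ (hm ▸ h3) w₁ h2 rfl ((h1.map_eq_one_iff hR).1 hw1))).mono
        (by omega)
  have := key w.norm w.toWord isReduced_toWord rfl (by rwa [mk_toWord])
  rwa [mk_toWord] at this

lemma HasDehnSteps.isDehnPresentation (h : HasDehnSteps φ R) (hφ : Function.Surjective φ)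
    (hfin : R.Finite) (hR : ∀ r ∈ R, φ r = 1) (hcyc : ∀ r ∈ R, IsCyclicallyReduced r.toWord) :
    IsDehnPresentation φ R where
  surjective := hφ
  finite := hfin
  normalClosure_eq := by
    refine le_antisymm (Subgroup.normalClosure_le_normal fun r hr ↦ hR r hr) fun w hw ↦ ?_
    exact (h.hasAreaLE_norm hR w hw).mem_normalClosure
  cyclicallyReduced := hcyc
  algorithm_works := by
    intro w w₁ hw hww₁ hno
    have h1 : IsReduced w₁ ∧ (φ (mk w) = 1 ↔ φ (mk w₁) = 1) := by
      clear hno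
      induction hww₁ with
      | refl => exact ⟨hw, Iff.rfl⟩
      | tail _ hs ih => exact ⟨hs.exists_mk_eq.1, ih.2.trans (hs.map_eq_one_iff hR)⟩
    rw [h1.2]
    refine ⟨?_, fun h2 ↦ ?_⟩
    · rintro rfl
      rw [← one_eq_mk, _root_.map_one]
    · by_contra hne
      obtain ⟨w₂, h3⟩ := h w₁ h1.1 hne h2
      exact hno w₂ h3

lemma exists_cancel_of_not_isReduced_append {u v : List (Fin n × Bool)} (hu : IsReduced u)
    (hv : IsReduced v) (huv : ¬ IsReduced (u ++ v)) :
    ∃ u₁ v₁ i b, u = u₁ ++ [(i, b)] ∧ v = (i, !b) :: v₁ := by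
  rw [FreeGroup.IsReduced, List.isChain_append] at huv
  push Not at huv
  obtain ⟨a, ha, c, hc, hac, hac'⟩ := huv hu hv
  obtain ⟨u₁, rfl⟩ := List.getLast?_eq_some_iff.1 ha
  obtain ⟨v₁, rfl⟩ := List.head?_eq_some_iff.1 hc
  refine ⟨u₁, v₁, a.1, a.2, rfl, ?_⟩
  obtain ⟨i, b⟩ := a
  obtain ⟨j, c⟩ := c
  simp only at hac hac'
  subst hac
  cases b <;> cases c <;> simp_all

/-- From a relation that consists of a word and a shorter word one obtains a cyclically reduced such
relation by cancelling. -/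
lemma exists_isCyclicallyReduced_append (φ : FreeGroup (Fin n) →* G) (u v : List (Fin n × Bool))
    (hu : IsReduced u) (hv : IsReduced v) (hvu : v.length < u.length)
    (huv : φ (mk (u ++ v)) = 1) :
    ∃ u₁ v₁, u₁ <:+: u ∧ v₁.length < u₁.length ∧ u₁.length + v₁.length ≤ u.length + v.length ∧
      φ (mk (u₁ ++ v₁)) = 1 ∧ IsCyclicallyReduced (u₁ ++ v₁) := by
  -- A cancellation at either junction of the cyclic word `u ++ v` takes one letter from each of `u`
  -- and `v`, so `v` remains shorter. Once `v` is empty, the cyclic reduction of `u` is an infix of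
  -- `u`, and it is non-empty because `u` is reduced and non-empty.
  induction hm : v.length generalizing u v with
  | zero =>
    obtain rfl := List.length_eq_zero_iff.1 hm
    have h1 := reduceCyclically.conj_conjugator_reduceCyclically u
    refine ⟨reduceCyclically u, [], ⟨_, _, h1⟩, ?_, ?_, ?_, ?_⟩
    · rw [List.length_nil, List.length_pos_iff]
      intro h
      rw [h, List.append_nil] at h1
      have h2 : reduce u = [] := by
        rw [← h1, ← toWord_mk, ← mul_mk, ← inv_mk, mul_inv_cancel, toWord_one]
      rw [hu.reduce_eq] at h2
      simp [h2] at hvu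
    · have := congrArg List.length h1
      simp only [List.length_append] at this
      simp only [List.length_nil]
      omega
    · rw [List.append_nil] at huv ⊢
      rwa [← h1, ← mul_mk, ← mul_mk, ← inv_mk, _root_.map_mul, _root_.map_mul, _root_.map_inv,
        conj_eq_one_iff] at huv
    · rw [List.append_nil]
      exact reduceCyclically.isCyclicallyReduced hu
  | succ m ih =>
    by_cases hred : IsReduced (u ++ v)
    · by_cases hred' : IsReduced (v ++ u)
      · refine ⟨u, v, List.infix_refl u, hvu, by omega, huv, hred, ?_⟩
        rw [FreeGroup.IsReduced, List.isChain_append] at hred'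
        have hu0 : u ≠ [] := by rintro rfl; simp at hvu
        have hv0 : v ≠ [] := by rintro rfl; simp at hm
        intro a ha b hb
        rw [List.getLast?_append_of_ne_nil _ hv0] at ha
        rw [List.head?_append_of_ne_nil _ hu0] at hb
        exact hred'.2.2 a ha b hb
      · obtain ⟨v', u', i, b, rfl, rfl⟩ := exists_cancel_of_not_isReduced_append hv hu hred'
        simp only [List.length_append, List.length_cons, List.length_nil] at hvu hm
        obtain ⟨u₁, v₁, h1, h2, h3, h4, h5⟩ := ih u' v' (hu.infix ⟨[(i, !b)], [], by simp⟩)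
          (hv.infix ⟨[], [(i, b)], by simp⟩) (by omega) (by
            have h6 : (mk ((i, !b) :: u' ++ (v' ++ [(i, b)])) : FreeGroup (Fin n)) =
                mk [(i, !b)] * mk (u' ++ v') * (mk [(i, !b)])⁻¹ := by
              rw [inv_mk, mul_mk, mul_mk]
              simp [invRev]
            rwa [h6, _root_.map_mul, _root_.map_mul, _root_.map_inv, conj_eq_one_iff] at huv)
          (by omega)
        refine ⟨u₁, v₁, h1.trans ⟨[(i, !b)], [], by simp⟩, h2, ?_, h4, h5⟩
        simp only [List.length_cons]
        omega
    · obtain ⟨u', v', i, b, rfl, rfl⟩ := exists_cancel_of_not_isReduced_append hu hv hred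
      simp only [List.length_append, List.length_cons, List.length_nil] at hvu hm
      obtain ⟨u₁, v₁, h1, h2, h3, h4, h5⟩ := ih u' v' (hu.infix ⟨[], [(i, b)], by simp⟩)
        (hv.infix ⟨[(i, !b)], [], by simp⟩) (by omega) (by
          have h6 : (mk (u' ++ [(i, b)] ++ (i, !b) :: v') : FreeGroup (Fin n)) =
              mk (u' ++ v') := by
            rw [List.append_assoc, List.singleton_append]
            exact Quot.sound Red.Step.not
          rwa [h6] at huv) (by omega)
      refine ⟨u₁, v₁, h1.trans ⟨[], [(i, b)], by simp⟩, h2, ?_, h4, h5⟩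
      simp only [List.length_append, List.length_cons, List.length_nil]
      omega

lemma shortRelators_finite (x : Fin n → G) (k : ℕ) : (shortRelators x k).Finite := by
  refine Set.Finite.subset ((List.finite_length_le (Fin n × Bool) k).preimage
    toWord_injective.injOn) fun r hr ↦ hr.2.1

lemma exists_reduced_word (x : Fin n → G) (hx : Subgroup.closure (Set.range x) = ⊤) (g : G) :
    ∃ v : List (Fin n × Bool), IsReduced v ∧ FreeGroup.lift x (mk v) = g ∧
      v.length ≤ (mulCayley (Set.range x)).dist 1 g := by
  have hΓ := mulCayley_connected hx
  obtain ⟨p, hp⟩ := hΓ.exists_walk_length_eq_dist 1 g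
  rw [← hp]
  clear hp
  have key : ∀ {h g : G} (p : (mulCayley (Set.range x)).Walk h g), ∃ w : FreeGroup (Fin n),
      h * FreeGroup.lift x w = g ∧ w.norm ≤ p.length := by
    intro h g p
    induction p with
    | nil => exact ⟨1, by simp, by simp⟩
    | @cons a b c e p ih =>
      obtain ⟨w, hw, hwp⟩ := ih
      obtain ⟨s, hs, hsn⟩ : ∃ s : FreeGroup (Fin n), a * FreeGroup.lift x s = b ∧ s.norm ≤ 1 := by
        obtain ⟨-, _, ⟨i, rfl⟩, h | h⟩ := (mulCayley_adj' _ _ _).1 e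
        · exact ⟨of i, by simpa using h, by simp⟩
        · exact ⟨(of i)⁻¹, by simp [h], by simp⟩
      refine ⟨s * w, by rw [_root_.map_mul, ← mul_assoc, hs, hw], ?_⟩
      have := norm_mul_le s w
      rw [Walk.length_cons]
      omega
  obtain ⟨w, hw, hwp⟩ := key p
  exact ⟨w.toWord, isReduced_toWord, by rwa [mk_toWord, ← one_mul (FreeGroup.lift x w)], hwp⟩

/-- If every non-empty word that represents `1` contains a short bump, then the short relators form
a Dehn presentation. -/
lemma hasDehnSteps_shortRelators {x : Fin n → G} (hx : Subgroup.closure (Set.range x) = ⊤) {C : ℕ}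
    (hC : ∀ w : List (Fin n × Bool), w ≠ [] → FreeGroup.lift x (mk w) = 1 →
      ∃ u : List (Fin n × Bool), u <:+: w ∧ u ≠ [] ∧ u.length ≤ C ∧ IsBump x u) :
    HasDehnSteps (FreeGroup.lift x) (shortRelators x (2 * C)) := by
  intro w hw hne hw1
  obtain ⟨u, huw, hu0, huC, hub⟩ := hC w hne hw1
  -- As `u` is a bump, `v` has at most a third of its length. So `u` is more than half of the
  -- relation `u v⁻¹`, whose length is at most `2 * C`.
  obtain ⟨v, hv, hvg, hvd⟩ := exists_reduced_word x hx (FreeGroup.lift x (mk u))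
  have hu0 := List.length_pos_iff.2 hu0
  unfold IsBump at hub
  obtain ⟨u₁, v₁, h1, h2, h3, h4, h5⟩ := exists_isCyclicallyReduced_append (FreeGroup.lift x) u
    (invRev v) (hw.infix huw)
    (by rw [isReduced_iff_reduce_eq, reduce_invRev, hv.reduce_eq])
    (by rw [invRev_length]; omega) (by rw [← mul_mk, ← inv_mk, _root_.map_mul, _root_.map_inv, hvg,
      mul_inv_cancel])
  rw [invRev_length] at h3
  obtain ⟨A, B, rfl⟩ := h1.trans huw
  have h6 : (mk (u₁ ++ v₁)).toWord = u₁ ++ v₁ := by rw [toWord_mk, h5.isReduced.reduce_eq]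
  refine ⟨_, mk (u₁ ++ v₁), ⟨by rwa [h6], ?_, h4⟩, u₁, v₁, B ++ A, Or.inl (by rw [h6]), h2, ?_, rfl⟩
  · refine norm_mk_le.trans ?_
    rw [List.length_append]
    omega
  · rw [← List.append_assoc]
    exact List.isRotated_append.trans (by rw [List.append_assoc])

end Dehn

/-! ### Independence of the generating family, and the Dehn functions. -/

section Main

open SimpleGraph FreeGroup

variable {G : Type*} [Group G] {n : ℕ}

lemma exists_bump_word_of_isRipsHyperbolic {x : Fin n → G} (hx : Subgroup.closure (Set.range x) = ⊤)
    {δ : ℝ} (hδ : (mulCayley (Set.range x)).IsRipsHyperbolic δ) :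
    ∃ C : ℕ, ∀ w : List (Fin n × Bool), w ≠ [] → FreeGroup.lift x (mk w) = 1 →
      ∃ u : List (Fin n × Bool), u <:+: w ∧ u ≠ [] ∧ u.length ≤ C ∧ IsBump x u := by
  have hΓ := mulCayley_connected hx
  obtain ⟨C, hC⟩ := (hδ.hasThinIntervals hΓ).exists_bump hΓ
  refine ⟨C, fun w hw hw1 ↦ ?_⟩
  have hlip : ∀ (h : G) (s : Fin n × Bool),
      (mulCayley (Set.range x)).dist h (h * FreeGroup.lift x (mk [s])) ≤ 1 := by
    intro h s
    rcases eq_or_ne h (h * FreeGroup.lift x (mk [s])) with he | he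
    · rw [← he, dist_self]
      exact Nat.zero_le _
    · refine (dist_eq_one_iff_adj.2 ((mulCayley_adj _ _ _).2 ⟨he, ?_⟩)).le
      obtain ⟨i, _ | _⟩ := s <;> simp
  obtain ⟨i, j, hij, hj, hlen, hb⟩ := hC (fun k ↦ FreeGroup.lift x (mk (w.take k))) w.length
    (List.length_pos_iff.2 hw) (fun k hk ↦ by
      have h1 : (mk (w.take (k + 1)) : FreeGroup (Fin n)) = mk (w.take k) * mk [w[k]] := by
        rw [mul_mk, List.take_append_getElem hk]
      simp only [h1, _root_.map_mul (FreeGroup.lift x)]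
      exact hlip _ _) (by simp [hw1, ← one_eq_mk])
  have hlen' : ((w.take j).drop i).length = j - i := by
    rw [List.length_drop, List.length_take, min_eq_left hj]
  refine ⟨(w.take j).drop i, (List.drop_suffix _ _).isInfix.trans (List.take_prefix _ _).isInfix,
    ?_, by omega, ?_⟩
  · rw [← List.length_pos_iff]
    omega
  · have h1 : (mk (w.take j) : FreeGroup (Fin n)) = mk (w.take i) * mk ((w.take j).drop i) := by
      have h2 := List.take_append_drop i (w.take j)
      rw [List.take_take, min_eq_left hij.le] at h2
      rw [mul_mk, h2]
    unfold IsBump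
    rw [mulCayley_dist_eq hΓ, h1, _root_.map_mul, inv_mul_cancel_left] at hb
    omega

lemma isDehnPresentation_shortRelators {x : Fin n → G} (hx : Subgroup.closure (Set.range x) = ⊤)
    {C : ℕ} (hC : ∀ w : List (Fin n × Bool), w ≠ [] → FreeGroup.lift x (mk w) = 1 →
      ∃ u : List (Fin n × Bool), u <:+: w ∧ u ≠ [] ∧ u.length ≤ C ∧ IsBump x u) :
    IsDehnPresentation (FreeGroup.lift x) (shortRelators x (2 * C)) :=
  (hasDehnSteps_shortRelators hx hC).isDehnPresentation
    (lift_surjective_iff_closure_range_eq_top.2 hx) (shortRelators_finite x _) (fun _ hr ↦ hr.2.2) (fun _ hr ↦ hr.1)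

lemma IsHyperbolicGroup.exists_generating_family (h : IsHyperbolicGroup G) :
    ∃ (n : ℕ) (x : Fin n → G) (δ : ℝ), Subgroup.closure (Set.range x) = ⊤ ∧
      (mulCayley (Set.range x)).IsRipsHyperbolic δ := by
  obtain ⟨S, hS, hS', δ, -, hδ⟩ := h
  obtain ⟨n, x, hx⟩ := hS.fin_param
  exact ⟨n, x, δ, by rwa [hx.2], by rwa [hx.2]⟩

/-- In the Cayley graph of a group with a finite Dehn presentation, with respect to any finite
generating set, geodesic triangles are thin. -/
theorem IsDehnPresentation.exists_isRipsHyperbolic {φ : FreeGroup (Fin n) →* G}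
    {R : Set (FreeGroup (Fin n))} (h : IsDehnPresentation φ R) {S : Set G} (hS : S.Finite)
    (hS' : Subgroup.closure S = ⊤) : ∃ δ : ℝ, 0 ≤ δ ∧ (mulCayley S).IsRipsHyperbolic δ := by
  have hR : ∀ r ∈ R, φ r = 1 := fun r hr ↦ h.toIsFinitePresentation.map_eq_one hr
  obtain ⟨K, hK⟩ := exists_hasLinearIntegrals h.surjective h.finite hR
    (h.hasDehnSteps.hasAreaLE_norm hR) hS hS'
  exact ⟨_, by positivity, hK.isRipsHyperbolic (mulCayley_connected hS')⟩

lemma IsHyperbolicGroup.hasFiniteDehnPresentation (h : IsHyperbolicGroup G) :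
    HasFiniteDehnPresentation G := by
  obtain ⟨n, x, δ, hx, hδ⟩ := h.exists_generating_family
  obtain ⟨C, hC⟩ := exists_bump_word_of_isRipsHyperbolic hx hδ
  exact ⟨n, _, _, isDehnPresentation_shortRelators hx hC⟩

lemma HasFiniteDehnPresentation.isHyperbolicGroup (h : HasFiniteDehnPresentation G) :
    IsHyperbolicGroup G := by
  obtain ⟨n, φ, R, h⟩ := h
  have hS : Subgroup.closure (Set.range fun i ↦ φ (of i)) = ⊤ := by
    rw [← FreeGroup.range_lift_eq_closure, MonoidHom.range_eq_top]
    convert h.surjective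
    ext
    simp
  exact ⟨_, Set.finite_range _, hS, h.exists_isRipsHyperbolic (Set.finite_range _) hS⟩

/-- The family `x` need not be related to the generators of the Dehn presentation: the integral
bounds make the Cayley graph of every finite generating set hyperbolic. -/
lemma HasFiniteDehnPresentation.exists_bump_word (h : HasFiniteDehnPresentation G) {x : Fin n → G}
    (hx : Subgroup.closure (Set.range x) = ⊤) :
    ∃ C : ℕ, ∀ w : List (Fin n × Bool), w ≠ [] → FreeGroup.lift x (mk w) = 1 →
      ∃ u : List (Fin n × Bool), u <:+: w ∧ u ≠ [] ∧ u.length ≤ C ∧ IsBump x u := by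
  obtain ⟨m, φ, R, h⟩ := h
  obtain ⟨δ, -, hδ⟩ := h.exists_isRipsHyperbolic (Set.finite_range x) hx
  exact exists_bump_word_of_isRipsHyperbolic hx hδ

lemma exists_hasAreaLE_of_mem_normalClosure {R : Set (FreeGroup (Fin n))} {w : FreeGroup (Fin n)}
    (hw : w ∈ Subgroup.normalClosure R) : ∃ N, HasAreaLE R w N := by
  rw [Subgroup.normalClosure] at hw
  induction hw using Subgroup.closure_induction with
  | mem y hy =>
    obtain ⟨r, hr, hry⟩ := Group.mem_conjugatesOfSet_iff.1 hy
    obtain ⟨s, rfl⟩ := isConj_iff.1 hry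
    exact ⟨1, (HasAreaLE.of_mem hr).conj s⟩
  | one => exact ⟨0, .one⟩
  | mul a b _ _ ha hb =>
    obtain ⟨M, hM⟩ := ha
    obtain ⟨N, hN⟩ := hb
    exact ⟨_, hM.mul hN⟩
  | inv a _ ha =>
    obtain ⟨M, hM⟩ := ha
    exact ⟨_, hM.inv⟩

/-- Over the short relators in the given generators, area is at most length. There are finitely many
of them, each with a finite filling over `R`, and substituting these fillings costs only a constant
factor. -/
lemma HasFiniteDehnPresentation.hasLinearDehnFunction (h : HasFiniteDehnPresentation G) :
    HasLinearDehnFunction G := by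
  intro n φ R hφR
  obtain ⟨x, rfl⟩ : ∃ x : Fin n → G, φ = FreeGroup.lift x :=
    ⟨fun i ↦ φ (of i), by ext; simp⟩
  have hx : Subgroup.closure (Set.range x) = ⊤ := by
    rw [← FreeGroup.range_lift_eq_closure, MonoidHom.range_eq_top]
    exact hφR.surjective
  obtain ⟨C, hC⟩ := h.exists_bump_word hx
  have hfill : ∀ r ∈ shortRelators x (2 * C), ∃ N, HasAreaLE R r N := by
    intro r hr
    apply exists_hasAreaLE_of_mem_normalClosure
    rw [hφR.normalClosure_eq]
    exact hr.2.2
  choose! N hN using hfill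
  obtain ⟨A, hA⟩ := ((shortRelators_finite x (2 * C)).image N).bddAbove
  refine ⟨A, fun k ↦ iSup₂_le fun w hw ↦ ?_⟩
  have h1 := (hasDehnSteps_shortRelators hx hC).hasAreaLE_norm (fun r hr ↦ hr.2.2) w hw.2
  exact ((h1.trans fun r hr ↦ (hN r hr).mono (hA ⟨r, hr, rfl⟩)).mono
    (Nat.mul_le_mul_left _ hw.1)).relatorArea_le

lemma HasFiniteDehnPresentation.isFinitelyPresented (h : HasFiniteDehnPresentation G) :
    Group.IsFinitelyPresented G := by
  obtain ⟨n, φ, R, h⟩ := h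
  exact ⟨n, φ, h.surjective, R, h.finite, h.normalClosure_eq⟩

end Main

theorem mainTheorem2 (G : Type*) [Group G] :
    (IsHyperbolicGroup G →
      Group.IsFinitelyPresented G ∧ HasFiniteDehnPresentation G ∧ HasLinearDehnFunction G) ∧
    (IsHyperbolicGroup G ↔ HasFiniteDehnPresentation G) ∧
    (IsHyperbolicGroup G →
      ∀ (n : ℕ) (x : Fin n → G), Subgroup.closure (Set.range x) = ⊤ →
        ∃ C : ℕ,
          (∀ w : List (Fin n × Bool), w ≠ [] → FreeGroup.lift x (FreeGroup.mk w) = 1 →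
            ∃ u : List (Fin n × Bool), u <:+: w ∧ u ≠ [] ∧ u.length ≤ C ∧ IsBump x u) ∧
          IsDehnPresentation (FreeGroup.lift x) (shortRelators x (2 * C))) := by
  refine ⟨fun h ↦ ?_, ⟨fun h ↦ h.hasFiniteDehnPresentation, fun h ↦ h.isHyperbolicGroup⟩,
    fun h n x hx ↦ ?_⟩
  · have hD := h.hasFiniteDehnPresentation
    exact ⟨hD.isFinitelyPresented, hD, hD.hasLinearDehnFunction⟩
  · obtain ⟨C, hC⟩ := h.hasFiniteDehnPresentation.exists_bump_word hx
    exact ⟨C, hC, isDehnPresentation_shortRelators hx hC⟩
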